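/- Independent Cutset is the following decision problem. Instance: a connected finite simple graph $G$. Question: is there a set $S\subseteq V(G)$ that is independent (its vertices are pairwise nonadjacent) and a cutset ($G-S$ is disconnected, i.e. has at least two connected components)? Independent Cutset can be solved in $\mathcal{O}^*(3^k)$ time, where $k=\alpha(G)$ is the independence number of the input graph. That is, there are a single algorithm (a program for a random access machine with logarithmic cost, with the number of vertices and the adjacency matrix of $G$ as its only input) and constants $C,c$ such that for every connected graph $G$ with vertex set $\{0,\dots,n-1\}$ the algorithm stops after time at most $C\cdot 3^{\alpha(G)}\cdot n^{c}$ and answers correctly whether $G$ has an independent cutset. -/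

import Mathlib

/-! ### Random access machines with logarithmic cost -/

namespace RAM

/-- Instructions of a random access machine. The machine has registers `R 0, R 1, …` holding
natural numbers and random access to a read-only input array. Registers and jump targets that
occur in an instruction are fixed numbers; indirect addressing is done by `read`, `load`, `store`. -/
inductive Instr where
  /-- `R d := c` -/
  | const (d c : ℕ)
  /-- `R d := R a + R b` -/
  | add (d a b : ℕ)
  /-- `R d := R a - R b` (truncated at `0`) -/
  | sub (d a b : ℕ)
  /-- `R d := R a * R b` -/
  | mul (d a b : ℕ)
  /-- `R d := ⌊R a / R b⌋` (and `0` if `R b = 0`) -/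
  | div (d a b : ℕ)
  /-- `R d := ` the input cell with address `R a` -/
  | read (d a : ℕ)
  /-- `R d := R (R a)` -/
  | load (d a : ℕ)
  /-- `R (R a) := R b` -/
  | store (a b : ℕ)
  /-- continue at instruction `l` -/
  | jump (l : ℕ)
  /-- continue at instruction `l` if `R a = 0` -/
  | jumpIfZero (a l : ℕ)
  /-- stop -/
  | halt

/-- A program is a finite list of instructions, numbered from `0`. -/
abbrev Program := List Instr

/-- A machine state: the number of the next instruction and the contents of the registers. -/
@[ext]
structure State where
  pc : ℕ
  reg : ℕ → ℕ

/-- The initial state: the first instruction is next, and all registers hold `0`. -/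
def State.init : State := ⟨0, fun _ => 0⟩

/-- Write `v` into register `d` and proceed to the next instruction. -/
def State.write (s : State) (d v : ℕ) : State := ⟨s.pc + 1, Function.update s.reg d v⟩

/-- One step with input array `x`: the successor state together with the cost of the step, which
is one plus the bit lengths (`Nat.size`) of the numbers and of the indirect addresses that the
instruction processes (the logarithmic cost criterion). The value is `none` if the machine has
stopped, that is, at a `halt` instruction or when no instruction with the current number exists. -/
def step (P : Program) (x : ℕ → ℕ) (s : State) : Option (State × ℕ) :=
  match P[s.pc]? with
  | none => none
  | some .halt => none
  | some (.const d c) => some (s.write d c, 1 + c.size)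
  | some (.add d a b) => some (s.write d (s.reg a + s.reg b), 1 + (s.reg a).size + (s.reg b).size)
  | some (.sub d a b) => some (s.write d (s.reg a - s.reg b), 1 + (s.reg a).size + (s.reg b).size)
  | some (.mul d a b) => some (s.write d (s.reg a * s.reg b), 1 + (s.reg a).size + (s.reg b).size)
  | some (.div d a b) => some (s.write d (s.reg a / s.reg b), 1 + (s.reg a).size + (s.reg b).size)
  | some (.read d a) => some (s.write d (x (s.reg a)), 1 + (s.reg a).size + (x (s.reg a)).size)
  | some (.load d a) =>
      some (s.write d (s.reg (s.reg a)), 1 + (s.reg a).size + (s.reg (s.reg a)).size)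
  | some (.store a b) => some (s.write (s.reg a) (s.reg b), 1 + (s.reg a).size + (s.reg b).size)
  | some (.jump l) => some (⟨l, s.reg⟩, 1)
  | some (.jumpIfZero a l) =>
      some (⟨if s.reg a = 0 then l else s.pc + 1, s.reg⟩, 1 + (s.reg a).size)

/-- `Exec P x s t s'`: started in state `s` with input array `x`, the program `P` stops, its final
state is `s'`, and its running time (the total cost of the steps) is `t`. -/
inductive Exec (P : Program) (x : ℕ → ℕ) : State → ℕ → State → Prop
  | halted {s : State} (h : step P x s = none) : Exec P x s 0 s
  | next {s s₁ s' : State} {c t : ℕ} (h : step P x s = some (s₁, c)) (hr : Exec P x s₁ t s') :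
      Exec P x s (c + t) s'

/-- On input `x`, the program `P` stops after time `t` with the number `y` in register `0`. -/
def Outputs (P : Program) (x : ℕ → ℕ) (y t : ℕ) : Prop :=
  ∃ s : State, Exec P x State.init t s ∧ s.reg 0 = y

end RAM

/-! ### Independent cutsets -/

namespace SimpleGraph

/-- `S` is a cutset of `G` if `G - S` is disconnected, i.e. two vertices outside `S` are not joined
by a path of `G - S`. (The graph without vertices does not count as disconnected.) -/
def IsCutset {V : Type*} (G : SimpleGraph V) (S : Set V) : Prop :=
  ¬ (G.induce Sᶜ).Preconnected

/-- `G` has a set of vertices that is both independent and a cutset. -/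
def HasIndepCutset {V : Type*} (G : SimpleGraph V) : Prop :=
  ∃ S : Set V, G.IsIndepSet S ∧ G.IsCutset S

open Classical in
/-- The input array that represents a graph with vertices `0, …, n - 1`: cell `0` holds `n`, the
next `n * n` cells hold the adjacency matrix row by row, and all further cells hold `0`. -/
noncomputable def inputArray {n : ℕ} (G : SimpleGraph (Fin n)) (a : ℕ) : ℕ :=
  if a = 0 then n
  else if ∃ i j : Fin n, a = 1 + (i : ℕ) * n + (j : ℕ) ∧ G.Adj i j then 1 else 0

end SimpleGraph

/-!
An independent cutset of `G` amounts to a colouring of the vertices by `0`, `1`, `2`, where `1` is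
the cutset and `0` and `2` are unions of components of the rest: the colours of adjacent vertices
must not add up to `2`, and the colours `0` and `2` must both occur (`hasIndepCutset_iff`). A
maximal independent set `D`, found greedily, has at most `α(G)` elements and is dominating. The
algorithm goes through the `3 ^ |D|` colourings of `D` and through the pairs of a vertex `a` of
colour `0` and a vertex `b` of colour `2`. A colour at a vertex excludes just one colour at each
neighbour, so, `D` being dominating, each vertex is left with at most two colours and the question
whether the colouring extends is an instance of 2-satisfiability. It is decided by unit
propagation: the colouring extends if and only if every vertex `v` has a colour such that
propagation from the given colours and this colour of `v` leaves a colour at every vertex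
(`Excluded.exists_coloring`, `Excluded.ne_of_coloring`).

For the machine, `RAM.FeasibleW` says that a function of the input and of some variables is
computed by relocatable code within a weight times a polynomial in the size of the input. Functions
of weight `1` are closed under arithmetic, reading the input, and primitive recursion with
polynomially many rounds whose intermediate values have polynomially many bits; hence under bounded
quantification, counting, and iteration of an operation on sets, which are coded by binary
expansions. So the algorithm needs only finitely many registers and no indirect addressing, and
each of its tests is feasible by the shape of its definition. The outer search is the only loop with
more than polynomially many rounds; it gets the weight `3 ^ α(G)`
(`RAM.FeasiblePred.exists_lt_weighted`).
-/

namespace RAM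

/-! ### Relocatable code -/

/-- The program `P` contains the instructions `is` from instruction number `l` on. -/
def CodeAt (P : Program) (l : ℕ) (is : List Instr) : Prop :=
  ∀ i (h : i < is.length), P[l + i]? = some is[i]

theorem CodeAt.left {P : Program} {l : ℕ} {c₁ c₂ : List Instr} (h : CodeAt P l (c₁ ++ c₂)) :
    CodeAt P l c₁ := by
  intro i hi
  rw [h i (by simp; omega), List.getElem_append_left hi]

theorem CodeAt.right {P : Program} {l : ℕ} {c₁ c₂ : List Instr} (h : CodeAt P l (c₁ ++ c₂)) :
    CodeAt P (l + c₁.length) c₂ := by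
  intro i hi
  rw [add_assoc, h (c₁.length + i) (by simp; omega), List.getElem_append_right (by omega)]
  simp

theorem CodeAt.head {P : Program} {l : ℕ} {a : Instr} {c : List Instr} (h : CodeAt P l (a :: c)) :
    P[l]? = some a := by
  exact h 0 (by simp)

theorem CodeAt.tail {P : Program} {l : ℕ} {a : Instr} {c : List Instr} (h : CodeAt P l (a :: c)) :
    CodeAt P (l + 1) c :=
  CodeAt.right (c₁ := [a]) h

/-- From state `s` the program reaches state `s'` in time `t`. This is stated through the halting
runs from `s'`, so that segments of a run compose by addition of their times. -/
def Reach (P : Program) (x : ℕ → ℕ) (s : State) (t : ℕ) (s' : State) : Prop :=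
  ∀ u s'', Exec P x s' u s'' → Exec P x s (t + u) s''

theorem Reach.trans {P : Program} {x : ℕ → ℕ} {s₁ s₂ s₃ : State} {t₁ t₂ : ℕ}
    (h₁ : Reach P x s₁ t₁ s₂) (h₂ : Reach P x s₂ t₂ s₃) : Reach P x s₁ (t₁ + t₂) s₃ := by
  intro u s'' h
  rw [add_assoc]
  exact h₁ _ _ (h₂ _ _ h)

theorem Reach.single {P : Program} {x : ℕ → ℕ} {s s₁ : State} {c : ℕ}
    (h : step P x s = some (s₁, c)) : Reach P x s c s₁ :=
  fun _ _ h' => Exec.next h h'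

/-! ### Families of inputs and functions computed in weighted polynomial time -/

/-- A family of input arrays, each with a size parameter that bounds the entries of the array. -/
structure InputFamily (ι : Type*) where
  cell : ι → ℕ → ℕ
  size : ι → ℕ
  two_le_size : ∀ k, 2 ≤ size k
  cell_le_size : ∀ k a, cell k a ≤ size k

variable {ι : Type*} {I : InputFamily ι}

/-- All values of the environment `e` have at most `N ^ p` bits. -/
def EnvBound (N p : ℕ) (e : ℕ → ℕ) : Prop := ∀ j, e j < 2 ^ N ^ p

/-- The values of `f` have polynomially many bits if the variables have. -/
def PolyBits (I : InputFamily ι) (f : ι → (ℕ → ℕ) → ℕ) : Prop :=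
  ∀ p, ∃ q, ∀ k e, EnvBound (I.size k) p e → f k e < 2 ^ I.size k ^ q

/-- The function `f` of the input and of an environment of variables is computed by relocatable
code in time `w k * size ^ q`, and its value has at most `size ^ q` bits, where the exponent `q`
depends only on the exponent `p` that bounds the bit lengths of the variables.

The code is given by the registers `ρ j` of the variables, the first free register `d` and the
first instruction number `l`; it leaves its result in register `d` and keeps the registers
below `d`. -/
structure FeasibleW (I : InputFamily ι) (w : ι → ℕ) (f : ι → (ℕ → ℕ) → ℕ) : Prop where
  polyBits : PolyBits I f
  exists_code : ∃ code : (ℕ → ℕ) → ℕ → ℕ → List Instr, ∀ p, ∃ q, ∀ (k : ι) (ρ : ℕ → ℕ) (d l : ℕ)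
    (P : Program) (r : ℕ → ℕ), (∀ j, ρ j < d) → EnvBound (I.size k) p (r ∘ ρ) →
    CodeAt P l (code ρ d l) →
    ∃ t r', Reach P (I.cell k) ⟨l, r⟩ t ⟨l + (code ρ d l).length, r'⟩ ∧
      t ≤ w k * I.size k ^ q ∧ r' d = f k (r ∘ ρ) ∧ ∀ j < d, r' j = r j

/-- The function `f` is computed by relocatable code in polynomial time. -/
abbrev Feasible (I : InputFamily ι) (f : ι → (ℕ → ℕ) → ℕ) : Prop := FeasibleW I (fun _ => 1) f

theorem InputFamily.one_le_size_pow (I : InputFamily ι) (k : ι) (q : ℕ) : 1 ≤ I.size k ^ q :=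
  Nat.one_le_pow _ _ (by have := I.two_le_size k; omega)

theorem InputFamily.size_pow_mono (I : InputFamily ι) (k : ι) {a b : ℕ} (h : a ≤ b) :
    I.size k ^ a ≤ I.size k ^ b :=
  Nat.pow_le_pow_right (by have := I.two_le_size k; omega) h

theorem InputFamily.two_pow_mul_le (I : InputFamily ι) (k : ι) (a b : ℕ) :
    2 ^ a * I.size k ^ b ≤ I.size k ^ (a + b) := by
  rw [pow_add]
  exact Nat.mul_le_mul_right _ (Nat.pow_le_pow_left (I.two_le_size k) a)

theorem InputFamily.two_pow_size_pow_mono (I : InputFamily ι) (k : ι) {a b : ℕ} (h : a ≤ b) :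
    2 ^ I.size k ^ a ≤ 2 ^ I.size k ^ b :=
  Nat.pow_le_pow_right (by omega) (I.size_pow_mono k h)

theorem InputFamily.le_size_pow (I : InputFamily ι) (k : ι) (c : ℕ) : c ≤ I.size k ^ c :=
  (Nat.lt_pow_self (I.two_le_size k)).le

theorem InputFamily.lt_two_pow (I : InputFamily ι) (k : ι) (c : ℕ) : c < 2 ^ I.size k ^ c :=
  Nat.lt_two_pow_self.trans_le (Nat.pow_le_pow_right (by omega) (I.le_size_pow k c))

theorem PolyBits.of_le {f g : ι → (ℕ → ℕ) → ℕ} (hg : PolyBits I g) (h : ∀ k e, f k e ≤ g k e) :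
    PolyBits I f := fun p =>
  let ⟨q, hq⟩ := hg p
  ⟨q, fun k e he => (h k e).trans_lt (hq k e he)⟩

theorem PolyBits.mul {f g : ι → (ℕ → ℕ) → ℕ} (hf : PolyBits I f) (hg : PolyBits I g) :
    PolyBits I fun k e => f k e * g k e := by
  intro p
  obtain ⟨a, ha⟩ := hf p
  obtain ⟨b, hb⟩ := hg p
  refine ⟨1 + (a + b), fun k e he => ?_⟩
  refine (Nat.mul_lt_mul'' (ha k e he) (hb k e he)).trans_le ?_
  rw [← pow_add]
  refine Nat.pow_le_pow_right (by omega) ((Nat.le_trans ?_ (I.two_pow_mul_le k 1 (a + b))))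
  have := I.size_pow_mono k (Nat.le_add_right a b)
  have := I.size_pow_mono k (Nat.le_add_left b a)
  omega

theorem PolyBits.add {f g : ι → (ℕ → ℕ) → ℕ} (hf : PolyBits I f) (hg : PolyBits I g) :
    PolyBits I fun k e => f k e + g k e := by
  intro p
  obtain ⟨a, ha⟩ := hf p
  obtain ⟨b, hb⟩ := hg p
  refine ⟨1 + (a + b), fun k e he => ?_⟩
  have h1 := (ha k e he).trans_le (I.two_pow_size_pow_mono k (Nat.le_add_right a b))
  have h2 := (hb k e he).trans_le (I.two_pow_size_pow_mono k (Nat.le_add_left b a))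
  refine lt_of_lt_of_le (b := 2 ^ (I.size k ^ (a + b) + 1)) (by simp only [pow_succ 2]; omega) ?_
  refine Nat.pow_le_pow_right (by omega) ((Nat.le_trans ?_ (I.two_pow_mul_le k 1 (a + b))))
  have := I.one_le_size_pow k (a + b)
  omega

/-! ### Closure under the operations of the machine -/

theorem feasible_const (c : ℕ) : Feasible I fun _ _ => c := by
  refine ⟨fun p => ⟨c, fun k e _ => I.lt_two_pow k c⟩, fun _ d _ => [.const d c], fun p =>
    ⟨1 + c, fun k ρ d l P r _ _ hP => ⟨1 + c.size, Function.update r d c, Reach.single ?_, ?_,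
      by simp, fun j hj => by simp [hj.ne]⟩⟩⟩
  · simp [step, hP.head, State.write]
  · have h1 : c.size ≤ I.size k ^ c := Nat.size_le.2 (I.lt_two_pow k c)
    have := I.two_pow_mul_le k 1 c
    have := I.one_le_size_pow k c
    omega

/-- Closure under a binary operation that one instruction carries out. -/
theorem FeasibleW.binary {f g : ι → (ℕ → ℕ) → ℕ} (op : ℕ → ℕ → ℕ)
    (instr : ℕ → ℕ → ℕ → Instr)
    (hstep : ∀ P x l r d a b, P[l]? = some (instr d a b) → step P x ⟨l, r⟩ =
      some (⟨l + 1, Function.update r d (op (r a) (r b))⟩, 1 + (r a).size + (r b).size))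
    (hf : Feasible I f) (hg : Feasible I g) (hbits : PolyBits I fun k e => op (f k e) (g k e)) :
    Feasible I fun k e => op (f k e) (g k e) := by
  refine ⟨hbits, ?_⟩
  obtain ⟨bf, cf, hf⟩ := hf
  obtain ⟨bg, cg, hg⟩ := hg
  refine ⟨fun ρ d l => cf ρ d l ++ (cg ρ (d + 1) (l + (cf ρ d l).length) ++ [instr d d (d + 1)]),
    fun p => ?_⟩
  obtain ⟨a, bf⟩ := bf p
  obtain ⟨b, bg⟩ := bg p
  obtain ⟨q₁, hf⟩ := hf p
  obtain ⟨q₂, hg⟩ := hg p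
  refine ⟨3 + (a + b + q₁ + q₂), fun k ρ d l P r hρ he hP => ?_⟩
  obtain ⟨t₁, r₁, h₁, ht₁, hv₁, hk₁⟩ := hf k ρ d l P r hρ he hP.left
  have e₁ : r₁ ∘ ρ = r ∘ ρ := funext fun j => hk₁ _ (hρ j)
  obtain ⟨t₂, r₂, h₂, ht₂, hv₂, hk₂⟩ := hg k ρ (d + 1) _ P r₁ (fun j => (hρ j).trans (by omega))
    (e₁ ▸ he) hP.right.left
  have h₃ := hstep P (I.cell k) _ r₂ _ _ _ hP.right.right.head
  refine ⟨_, _, (h₁.trans h₂).trans (by simpa [add_assoc] using Reach.single h₃), ?_, ?_, ?_⟩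
  · have s₁ : (r₂ d).size ≤ I.size k ^ a := by
      rw [Nat.size_le, hk₂ d (by omega), hv₁]; exact bf k _ he
    have s₂ : (r₂ (d + 1)).size ≤ I.size k ^ b := by
      rw [Nat.size_le, hv₂, e₁]; exact bg k _ he
    have := I.size_pow_mono k (show a ≤ a + b + q₁ + q₂ by omega)
    have := I.size_pow_mono k (show b ≤ a + b + q₁ + q₂ by omega)
    have := I.size_pow_mono k (show q₁ ≤ a + b + q₁ + q₂ by omega)
    have := I.size_pow_mono k (show q₂ ≤ a + b + q₁ + q₂ by omega)
    have := I.one_le_size_pow k (a + b + q₁ + q₂)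
    have := I.two_pow_mul_le k 3 (a + b + q₁ + q₂)
    omega
  · simp [hv₂, hk₂ d, hv₁, e₁]
  · intro j hj
    simp [hj.ne, hk₂ j (by omega), hk₁ j hj]

theorem FeasibleW.add {f g : ι → (ℕ → ℕ) → ℕ} (hf : Feasible I f) (hg : Feasible I g) :
    Feasible I fun k e => f k e + g k e :=
  .binary (· + ·) .add (fun P x l r d a b h => by simp [step, h, State.write]) hf hg
    (hf.polyBits.add hg.polyBits)

theorem FeasibleW.mul {f g : ι → (ℕ → ℕ) → ℕ} (hf : Feasible I f) (hg : Feasible I g) :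
    Feasible I fun k e => f k e * g k e :=
  .binary (· * ·) .mul (fun P x l r d a b h => by simp [step, h, State.write]) hf hg
    (hf.polyBits.mul hg.polyBits)

theorem FeasibleW.sub {f g : ι → (ℕ → ℕ) → ℕ} (hf : Feasible I f) (hg : Feasible I g) :
    Feasible I fun k e => f k e - g k e :=
  .binary (· - ·) .sub (fun P x l r d a b h => by simp [step, h, State.write]) hf hg
    (hf.polyBits.of_le fun _ _ => Nat.sub_le _ _)

theorem FeasibleW.div {f g : ι → (ℕ → ℕ) → ℕ} (hf : Feasible I f) (hg : Feasible I g) :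
    Feasible I fun k e => f k e / g k e :=
  .binary (· / ·) .div (fun P x l r d a b h => by simp [step, h, State.write]) hf hg
    (hf.polyBits.of_le fun _ _ => Nat.div_le_self _ _)

theorem feasible_var (j : ℕ) : Feasible I fun _ e => e j := by
  refine ⟨fun p => ⟨p, fun k e he => he j⟩,
    -- The machine has no instruction that copies a register, so `0` is added.
    fun ρ d _ => [.const d 0, .add d (ρ j) d], fun p =>
    ⟨2 + p, fun k ρ d l P r hρ he hP => ⟨1 + (1 + (r (ρ j)).size),
      Function.update (Function.update r d 0) d (r (ρ j)), ?_, ?_, by simp,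
      fun i hi => by simp [hi.ne]⟩⟩⟩
  · have h₁ := hP.head
    have h₂ := hP.tail.head
    refine Reach.trans (s₂ := ⟨l + 1, Function.update r d 0⟩) (Reach.single ?_) (Reach.single ?_)
    · simp [step, h₁, State.write]
    · simp [step, h₂, State.write, (hρ j).ne]
  · have h1 : (r (ρ j)).size ≤ I.size k ^ p := Nat.size_le.2 (he j)
    have := I.two_pow_mul_le k 2 p
    have := I.one_le_size_pow k p
    omega

theorem FeasibleW.cell {f : ι → (ℕ → ℕ) → ℕ} (hf : Feasible I f) :
    Feasible I fun k e => I.cell k (f k e) := by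
  obtain ⟨bf, cf, hf⟩ := hf
  have hc (k : ι) (a : ℕ) : I.cell k a < 2 ^ I.size k ^ 1 := by
    rw [pow_one]; exact (I.cell_le_size k _).trans_lt Nat.lt_two_pow_self
  refine ⟨fun p => ⟨1, fun k e _ => hc k _⟩,
    fun ρ d l => cf ρ d l ++ [.read d d], fun p => ?_⟩
  obtain ⟨a, bf⟩ := bf p
  obtain ⟨q, hf⟩ := hf p
  refine ⟨2 + (a + q + 1), fun k ρ d l P r hρ he hP => ?_⟩
  obtain ⟨t, r', h, ht, hv, hk⟩ := hf k ρ d l P r hρ he hP.left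
  refine ⟨t + (1 + (r' d).size + (I.cell k (r' d)).size), Function.update r' d (I.cell k (r' d)),
    h.trans (Reach.single ?_), ?_, by simp [hv], fun j hj => by simp [hj.ne, hk j hj]⟩
  · simp [step, hP.right.head, State.write, add_assoc]
  · have s₁ : (r' d).size ≤ I.size k ^ a := by
      rw [Nat.size_le, hv]; exact bf k _ he
    have s₂ : (I.cell k (r' d)).size ≤ I.size k ^ 1 := Nat.size_le.2 (hc k _)
    have := I.size_pow_mono k (show a ≤ a + q + 1 by omega)
    have := I.size_pow_mono k (show q ≤ a + q + 1 by omega)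
    have := I.size_pow_mono k (show 1 ≤ a + q + 1 by omega)
    have := I.one_le_size_pow k (a + q + 1)
    have := I.two_pow_mul_le k 2 (a + q + 1)
    omega

/-! ### Closure under bounded primitive recursion -/

/-- Primitive recursion: start with `a`, and pass from the value at `j` to the value at `j + 1`
by `F j`. -/
def primRec (a : ℕ) (F : ℕ → ℕ → ℕ) : ℕ → ℕ
  | 0 => a
  | m + 1 => F m (primRec a F m)

/-- The environment `e` extended by the two newest variables, `a` (number `0`) and `i`
(number `1`). -/
def extendEnv {α : Type*} (a i : α) (e : ℕ → α) : ℕ → α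
  | 0 => a
  | 1 => i
  | j + 2 => e j

/-- Primitive recursion with `w * poly` rounds takes time `w * poly` if a round takes polynomial
time and the intermediate values have polynomially many bits. In the environment of a round, the
variables `0` and `1` are the accumulator and the number of the round. -/
theorem Feasible.primRec_weighted {w : ι → ℕ} (hw : ∀ k, 1 ≤ w k)
    {g a : ι → (ℕ → ℕ) → ℕ} {F : ι → (ℕ → ℕ) → ℕ → ℕ → ℕ}
    (hg : Feasible I g) (ha : Feasible I a)
    (hF : Feasible I fun k e => F k (fun j => e (j + 2)) (e 1) (e 0))
    (hgw : ∃ q, ∀ k e, g k e ≤ w k * I.size k ^ q)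
    (hb : ∀ p, ∃ q, ∀ k e, EnvBound (I.size k) p e → ∀ m ≤ g k e,
      primRec (a k e) (F k e) m < 2 ^ I.size k ^ q) :
    FeasibleW I w fun k e => primRec (a k e) (F k e) (g k e) := by
  refine ⟨fun p => (hb p).imp fun q hq k e he => hq k e he _ le_rfl, ?_⟩
  obtain ⟨bg, cg, hg⟩ := hg
  obtain ⟨-, ca, ha⟩ := ha
  obtain ⟨bF, cF, hF⟩ := hF
  obtain ⟨qw, hgw⟩ := hgw
  -- Register `d` holds the accumulator, `d + 1` the number of rounds, `d + 2` the number of the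
  -- current round, `d + 3` the constant `1`; the registers from `d + 4` on are free.
  let ρ' (ρ : ℕ → ℕ) (d : ℕ) : ℕ → ℕ := extendEnv d (d + 2) ρ
  let body (ρ : ℕ → ℕ) (d l : ℕ) : List Instr := cF (ρ' ρ d) (d + 4) l
  let pre (ρ : ℕ → ℕ) (d l : ℕ) : List Instr := ca ρ d l ++ cg ρ (d + 1) (l + (ca ρ d l).length)
  let loopCode (ρ : ℕ → ℕ) (d l : ℕ) : List Instr :=
    .sub (d + 4) (d + 1) (d + 2) ::
    .jumpIfZero (d + 4) (l + 2 + (body ρ d (l + 2)).length + 4) ::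
    (body ρ d (l + 2) ++ [.const (d + 5) 0, .add d (d + 4) (d + 5),
      .add (d + 2) (d + 2) (d + 3), .jump l])
  refine ⟨fun ρ d l => pre ρ d l ++ .const (d + 2) 0 :: .const (d + 3) 1 ::
    loopCode ρ d (l + (pre ρ d l).length + 2), fun p => ?_⟩
  obtain ⟨b₁, bg⟩ := bg p
  obtain ⟨b₂, hb⟩ := hb p
  obtain ⟨q₁, hg⟩ := hg p
  obtain ⟨q₂, ha⟩ := ha p
  obtain ⟨q₃, hF⟩ := hF (p + b₁ + b₂)
  let Q := b₁ + b₂ + q₁ + q₂ + q₃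
  refine ⟨5 + Q + qw + 2, fun k ρ d l P r hρ he hP => ?_⟩
  obtain ⟨t₁, r₁, h₁, ht₁, hv₁, hk₁⟩ := ha k ρ d l P r hρ he hP.left.left
  have e₁ : r₁ ∘ ρ = r ∘ ρ := funext fun j => hk₁ _ (hρ j)
  obtain ⟨t₂, r₂, h₂, ht₂, hv₂, hk₂⟩ := hg k ρ (d + 1) _ P r₁ (fun j => (hρ j).trans (by omega))
    (e₁ ▸ he) hP.left.right
  have hP₁ := hP.right.head
  have hP₂ := hP.right.tail.head
  have hP₃ : CodeAt P _ (loopCode ρ d (l + (pre ρ d l).length + 2)) := hP.right.tail.tail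
  set L := l + (pre ρ d l).length + 2 with hL
  set e := r ∘ ρ
  set m := g k e with hm
  have hQ : ∀ a ≤ Q, I.size k ^ a ≤ I.size k ^ Q := fun a h => I.size_pow_mono k h
  have hQ1 := hQ b₁ (by omega)
  have hQ2 := hQ b₂ (by omega)
  have hQ3 := hQ q₁ (by omega)
  have hQ4 := hQ q₂ (by omega)
  have hQ5 := hQ q₃ (by omega)
  have hQ0 := I.one_le_size_pow k Q
  have hmb : m < 2 ^ I.size k ^ b₁ := bg k e he
  let E := L + 2 + (body ρ d (L + 2)).length + 4
  -- The loop, by induction on the number of remaining rounds.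
  have loop : ∀ c i r', c + i = m → (∀ j < d, r' j = r j) →
      r' d = primRec (a k e) (F k e) i → r' (d + 1) = m → r' (d + 2) = i → r' (d + 3) = 1 →
      ∃ t r'', Reach P (I.cell k) ⟨L, r'⟩ t ⟨E, r''⟩ ∧ t ≤ (c + 1) * (2 ^ 4 * I.size k ^ Q) ∧
        r'' d = primRec (a k e) (F k e) m ∧ ∀ j < d, r'' j = r j := by
    intro c
    induction c with
    | zero =>
      intro i r' hi hk hv hd1 hd2 hd3
      have hs : (r' (d + 1)).size ≤ I.size k ^ b₁ := by rw [Nat.size_le, hd1]; exact hmb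
      have hi' : i = m := by omega
      refine ⟨_, _, (Reach.single (s₁ := ⟨L + 1, Function.update r' (d + 4) 0⟩) (?_ :
        _ = some (_, 1 + m.size + m.size))).trans
          (Reach.single (s₁ := ⟨E, Function.update r' (d + 4) 0⟩) (?_ : _ = some (_, 1))),
          ?_, ?_, ?_⟩
      · simp [step, hP₃.head, State.write, hd1, hd2, hi']
      · simp [step, hP₃.tail.head, E]
      · rw [hd1] at hs
        omega
      · simp [hv, hi']
      · intro j hj
        simp [hk j hj, show j ≠ d + 4 by omega]
    | succ c ih =>
      intro i r' hi hk hv hd1 hd2 hd3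
      have him : i < m := by omega
      have hs1 : m.size ≤ I.size k ^ b₁ := Nat.size_le.2 hmb
      have hs2 : i.size ≤ I.size k ^ b₁ := Nat.size_le.2 (him.trans hmb)
      have hs3 : (m - i).size ≤ I.size k ^ b₁ :=
        Nat.size_le.2 ((Nat.sub_le _ _).trans_lt hmb)
      let ra := Function.update r' (d + 4) (m - i)
      have hra : ∀ j < d + 4, ra j = r' j := fun j hj => by simp [ra, show j ≠ d + 4 by omega]
      have s₁ : Reach P (I.cell k) ⟨L, r'⟩ (1 + m.size + i.size) ⟨L + 1, ra⟩ := Reach.single (by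
        simp [step, hP₃.head, State.write, hd1, hd2, ra])
      have s₂ : Reach P (I.cell k) ⟨L + 1, ra⟩ (1 + (m - i).size) ⟨L + 2, ra⟩ := Reach.single (by
        simp [step, hP₃.tail.head, ra, show m - i ≠ 0 by omega])
      have hρ' : ∀ j, ρ' ρ d j < d + 4
        | 0 => by simp [ρ', extendEnv]
        | 1 => by simp [ρ', extendEnv]
        | j + 2 => (hρ j).trans (by omega)
      have hraρ : (fun j => (ra ∘ ρ' ρ d) (j + 2)) = e := funext fun j => by
        simp [ρ', extendEnv, hra _ ((hρ j).trans (show d < d + 4 by omega)), hk _ (hρ j), e]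
      have hra0 : (ra ∘ ρ' ρ d) 0 = primRec (a k e) (F k e) i := by
        simp [ρ', extendEnv, hra, hv]
      have hra1 : (ra ∘ ρ' ρ d) 1 = i := by
        simp [ρ', extendEnv, hra, hd2]
      have heb : EnvBound (I.size k) (p + b₁ + b₂) (ra ∘ ρ' ρ d) := by
        intro j
        match j with
        | 0 =>
          rw [hra0]
          exact (hb k e he i him.le).trans_le (I.two_pow_size_pow_mono k (by omega))
        | 1 =>
          rw [hra1]
          exact (him.trans hmb).trans_le (I.two_pow_size_pow_mono k (by omega))
        | j + 2 =>
          rw [show (ra ∘ ρ' ρ d) (j + 2) = e j from congrFun hraρ j]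
          exact (he j).trans_le (I.two_pow_size_pow_mono k (by omega))
      obtain ⟨t₃, rb, s₃, ht₃, hvb, hkb⟩ := hF k (ρ' ρ d) (d + 4) (L + 2) P ra hρ' heb
        hP₃.tail.tail.left
      rw [hraρ, hra0, hra1] at hvb
      change rb (d + 4) = primRec (a k e) (F k e) (i + 1) at hvb
      have hend := hP₃.tail.tail.right
      let l' := L + 2 + (body ρ d (L + 2)).length
      change CodeAt P l' _ at hend
      let v := primRec (a k e) (F k e) (i + 1)
      have hs4 : v.size ≤ I.size k ^ b₂ := Nat.size_le.2 (hb k e he (i + 1) him)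
      have hrb2 : rb (d + 2) = i := by rw [hkb _ (by omega), hra _ (by omega), hd2]
      have hrb3 : rb (d + 3) = 1 := by rw [hkb _ (by omega), hra _ (by omega), hd3]
      have s₄ : Reach P (I.cell k) ⟨l', rb⟩ 1 ⟨l' + 1, Function.update rb (d + 5) 0⟩ :=
        Reach.single (by simp [step, hend.head, State.write])
      let rc := Function.update (Function.update rb (d + 5) 0) d v
      have s₅ : Reach P (I.cell k) ⟨l' + 1, Function.update rb (d + 5) 0⟩ (1 + v.size)
          ⟨l' + 2, rc⟩ :=
        Reach.single (by simp [step, hend.tail.head, State.write, hvb, rc, v])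
      have s₆ : Reach P (I.cell k) ⟨l' + 2, rc⟩ (1 + i.size + 1)
          ⟨l' + 3, Function.update rc (d + 2) (i + 1)⟩ :=
        Reach.single (by simp [step, hend.tail.tail.head, State.write, hrb2, hrb3, rc])
      have s₇ : Reach P (I.cell k) ⟨l' + 3, Function.update rc (d + 2) (i + 1)⟩ 1
          ⟨L, Function.update rc (d + 2) (i + 1)⟩ :=
        Reach.single (by simp [step, hend.tail.tail.tail.head])
      obtain ⟨t, r'', s₈, ht, hv'', hk''⟩ := ih (i + 1) (Function.update rc (d + 2) (i + 1))
        (by omega)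
        (fun j hj => by
          simp [rc, hj.ne, show j ≠ d + 2 by omega, show j ≠ d + 5 by omega, hkb j (by omega),
            hra j (by omega), hk j hj])
        (by simp [rc, v])
        (by simp [rc, hkb, hra, hd1])
        (by simp)
        (by simp [rc, hrb3])
      refine ⟨_, r'', (s₁.trans s₂).trans (s₃.trans (s₄.trans (s₅.trans (s₆.trans
        (s₇.trans s₈))))), ?_, hv'', hk''⟩
      have : (c + 1 + 1) * (2 ^ 4 * I.size k ^ Q) =
        (c + 1) * (2 ^ 4 * I.size k ^ Q) + 2 ^ 4 * I.size k ^ Q := by ring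
      omega
  obtain ⟨t₃, r₃, h₃, ht₃, hv₃, hk₃⟩ := loop m 0
    (Function.update (Function.update r₂ (d + 2) 0) (d + 3) 1) (by omega)
    (fun j hj => by
      simp [show j ≠ d + 2 by omega, show j ≠ d + 3 by omega, hk₂ j (by omega), hk₁ j hj])
    (by simp [hk₂ d, hv₁, primRec])
    (by simp [hv₂, e₁, hm])
    (by simp) (by simp)
  have s₁ : Reach P (I.cell k) ⟨l + (pre ρ d l).length, r₂⟩ 1
      ⟨l + (pre ρ d l).length + 1, Function.update r₂ (d + 2) 0⟩ :=
    Reach.single (by simp [step, hP₁, State.write])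
  have s₂ : Reach P (I.cell k) ⟨l + (pre ρ d l).length + 1, Function.update r₂ (d + 2) 0⟩ 2
      ⟨L, Function.update (Function.update r₂ (d + 2) 0) (d + 3) 1⟩ :=
    Reach.single (by simp [step, hP₂, State.write, L])
  have h₂' := h₁.trans h₂
  rw [show l + (ca ρ d l).length + (cg ρ (d + 1) (l + (ca ρ d l).length)).length =
    l + (pre ρ d l).length by simp [pre, add_assoc]] at h₂'
  have hE : E = l + (pre ρ d l ++ Instr.const (d + 2) 0 :: Instr.const (d + 3) 1 ::
      loopCode ρ d L).length := by
    simp [E, loopCode, hL]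
    omega
  rw [hE] at h₃
  refine ⟨_, r₃, h₂'.trans (s₁.trans (s₂.trans h₃)), ?_, hv₃, hk₃⟩
  · have hw1 := hw k
    have hmw : m + 1 ≤ 2 * (w k * I.size k ^ qw) := by
      have := hgw k e
      have : 1 * 1 ≤ w k * I.size k ^ qw := Nat.mul_le_mul hw1 (I.one_le_size_pow k qw)
      omega
    have h1 : (m + 1) * (2 ^ 4 * I.size k ^ Q) ≤ w k * (2 ^ 5 * I.size k ^ (Q + qw)) := by
      refine (Nat.mul_le_mul_right _ hmw).trans_eq ?_
      ring
    have h2 : I.size k ^ Q ≤ w k * (I.size k ^ (Q + qw)) :=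
      (I.size_pow_mono k (by omega)).trans (Nat.le_mul_of_pos_left _ hw1)
    have h3 : w k * (2 ^ 7 * I.size k ^ (Q + qw)) ≤ w k * I.size k ^ (5 + Q + qw + 2) :=
      Nat.mul_le_mul_left _ ((I.two_pow_mul_le k 7 _).trans (I.size_pow_mono k (by omega)))
    have h4 : w k * (2 ^ 7 * I.size k ^ (Q + qw)) = 128 * (w k * I.size k ^ (Q + qw)) := by ring
    have h5 : w k * (2 ^ 5 * I.size k ^ (Q + qw)) = 32 * (w k * I.size k ^ (Q + qw)) := by ring
    omega

theorem FeasibleW.primRec {g a : ι → (ℕ → ℕ) → ℕ} {F : ι → (ℕ → ℕ) → ℕ → ℕ → ℕ}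
    (hg : Feasible I g) (ha : Feasible I a)
    (hF : Feasible I fun k e => F k (fun j => e (j + 2)) (e 1) (e 0))
    (hgw : ∃ q, ∀ k e, g k e ≤ I.size k ^ q)
    (hb : ∀ p, ∃ q, ∀ k e, EnvBound (I.size k) p e → ∀ m ≤ g k e,
      primRec (a k e) (F k e) m < 2 ^ I.size k ^ q) :
    Feasible I fun k e => primRec (a k e) (F k e) (g k e) :=
  Feasible.primRec_weighted (fun _ => le_rfl) hg ha hF (by simpa using hgw) hb

/-! ### Feasible predicates and bounded quantifiers -/

/-- The variables of a feasible function may be renamed. -/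
theorem FeasibleW.rename {f : ι → (ℕ → ℕ) → ℕ} (hf : Feasible I f) (σ : ℕ → ℕ) :
    Feasible I fun k e => f k fun j => e (σ j) := by
  obtain ⟨b, c, h⟩ := hf
  refine ⟨fun p => (b p).imp fun q hq k e he => hq k _ fun j => he _,
    fun ρ d l => c (ρ ∘ σ) d l, fun p => (h p).imp fun q hq k ρ d l P r hρ he hP =>
      hq k (ρ ∘ σ) d l P r (fun j => hρ _) (fun j => he _) hP⟩

open Classical in
/-- The predicate `p` of the input and of the variables is decided in polynomial time. -/
def FeasiblePred (I : InputFamily ι) (p : ι → (ℕ → ℕ) → Prop) : Prop :=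
  Feasible I fun k e => if p k e then 1 else 0

/-- The value of `g` is bounded by a polynomial in the size of the input alone. -/
def PolyVal (I : InputFamily ι) (g : ι → (ℕ → ℕ) → ℕ) : Prop := ∃ q, ∀ k e, g k e ≤ I.size k ^ q

theorem PolyVal.of_le {f g : ι → (ℕ → ℕ) → ℕ} (hg : PolyVal I g) (h : ∀ k e, f k e ≤ g k e) :
    PolyVal I f :=
  hg.imp fun _ hq k e => (h k e).trans (hq k e)

theorem polyVal_const (c : ℕ) : PolyVal I fun _ _ => c := ⟨c, fun k _ => I.le_size_pow k c⟩

theorem PolyVal.mul {f g : ι → (ℕ → ℕ) → ℕ} (hf : PolyVal I f) (hg : PolyVal I g) :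
    PolyVal I fun k e => f k e * g k e := by
  obtain ⟨a, ha⟩ := hf
  obtain ⟨b, hb⟩ := hg
  exact ⟨a + b, fun k e => (Nat.mul_le_mul (ha k e) (hb k e)).trans_eq (pow_add ..).symm⟩

theorem PolyVal.cell (a : ι → (ℕ → ℕ) → ℕ) : PolyVal I fun k e => I.cell k (a k e) :=
  ⟨1, fun k e => by simpa using I.cell_le_size k (a k e)⟩

theorem FeasibleW.congr {w : ι → ℕ} {f g : ι → (ℕ → ℕ) → ℕ} (hf : FeasibleW I w f)
    (h : ∀ k e, g k e = f k e) : FeasibleW I w g := by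
  rwa [show g = f from funext fun k => funext (h k)]

theorem FeasiblePred.congr {p q : ι → (ℕ → ℕ) → Prop} (hp : FeasiblePred I p)
    (h : ∀ k e, q k e ↔ p k e) : FeasiblePred I q := by
  rwa [show q = p from funext fun k => funext fun e => propext (h k e)]

theorem FeasiblePred.not {p : ι → (ℕ → ℕ) → Prop} (hp : FeasiblePred I p) :
    FeasiblePred I fun k e => ¬ p k e :=
  FeasibleW.congr ((feasible_const 1).sub hp) fun k e => by by_cases h : p k e <;> simp [h]

theorem FeasiblePred.and {p q : ι → (ℕ → ℕ) → Prop} (hp : FeasiblePred I p)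
    (hq : FeasiblePred I q) : FeasiblePred I fun k e => p k e ∧ q k e :=
  FeasibleW.congr (FeasibleW.mul hp hq) fun k e => by
    by_cases h : p k e <;> by_cases h' : q k e <;> simp [h, h']

theorem FeasiblePred.or {p q : ι → (ℕ → ℕ) → Prop} (hp : FeasiblePred I p)
    (hq : FeasiblePred I q) : FeasiblePred I fun k e => p k e ∨ q k e :=
  (hp.not.and hq.not).not.congr fun k e => by tauto

theorem FeasiblePred.imp {p q : ι → (ℕ → ℕ) → Prop} (hp : FeasiblePred I p)
    (hq : FeasiblePred I q) : FeasiblePred I fun k e => p k e → q k e :=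
  (hp.not.or hq).congr fun k e => by tauto

theorem FeasiblePred.lt {f g : ι → (ℕ → ℕ) → ℕ} (hf : Feasible I f) (hg : Feasible I g) :
    FeasiblePred I fun k e => f k e < g k e :=
  FeasibleW.congr ((feasible_const 1).sub ((feasible_const 1).sub (hg.sub hf))) fun k e => by
    split_ifs <;> omega

theorem FeasiblePred.eq {f g : ι → (ℕ → ℕ) → ℕ} (hf : Feasible I f) (hg : Feasible I g) :
    FeasiblePred I fun k e => f k e = g k e :=
  ((FeasiblePred.lt hf hg).not.and (FeasiblePred.lt hg hf).not).congr fun k e => by omega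

theorem FeasiblePred.ne {f g : ι → (ℕ → ℕ) → ℕ} (hf : Feasible I f) (hg : Feasible I g) :
    FeasiblePred I fun k e => f k e ≠ g k e :=
  (FeasiblePred.eq hf hg).not

theorem FeasiblePred.ite {p : ι → (ℕ → ℕ) → Prop} {_ : ∀ k e, Decidable (p k e)}
    {f g : ι → (ℕ → ℕ) → ℕ}
    (hp : FeasiblePred I p) (hf : Feasible I f) (hg : Feasible I g) :
    Feasible I fun k e => if p k e then f k e else g k e :=
  FeasibleW.congr ((FeasibleW.mul hp hf).add (FeasibleW.mul hp.not hg)) fun k e => by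
    by_cases h : p k e <;> simp [h]

theorem FeasibleW.mod {f g : ι → (ℕ → ℕ) → ℕ} (hf : Feasible I f) (hg : Feasible I g) :
    Feasible I fun k e => f k e % g k e :=
  (hf.sub (hg.mul (hf.div hg))).congr fun _ _ => Nat.mod_eq_sub_mul_div

theorem FeasibleW.min {f g : ι → (ℕ → ℕ) → ℕ} (hf : Feasible I f) (hg : Feasible I g) :
    Feasible I fun k e => min (f k e) (g k e) :=
  (hf.sub (hf.sub hg)).congr fun k e => by omega

open Classical in
theorem primRec_ite_one (p : ℕ → Prop) (m : ℕ) :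
    primRec 0 (fun i acc => if p i then 1 else acc) m = if ∃ i < m, p i then 1 else 0 := by
  induction m with
  | zero => simp [primRec]
  | succ m ih =>
    simp only [primRec, ih, Nat.lt_succ_iff_lt_or_eq, or_and_right, exists_or, exists_eq_left]
    by_cases h : p m <;> simp [h]

open Classical in
/-- Search through `w * poly` candidates that can be tested in polynomial time. -/
theorem FeasiblePred.exists_lt_weighted {w : ι → ℕ} (hw : ∀ k, 1 ≤ w k)
    {g : ι → (ℕ → ℕ) → ℕ} {p : ι → (ℕ → ℕ) → ℕ → Prop}
    (hg : Feasible I g) (hgw : ∃ q, ∀ k e, g k e ≤ w k * I.size k ^ q)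
    (hp : FeasiblePred I fun k e => p k (fun j => e (j + 2)) (e 1)) :
    FeasibleW I w fun k e => if ∃ i < g k e, p k e i then 1 else 0 := by
  refine (Feasible.primRec_weighted hw hg (feasible_const 0) (F := fun k e i acc =>
    if p k e i then 1 else acc) (hp.ite (feasible_const 1) (feasible_var 0)) hgw fun _ =>
      ⟨1, fun k e _ m _ => ?_⟩).congr fun k e => (primRec_ite_one _ _).symm
  rw [primRec_ite_one]
  have := I.lt_two_pow k 1
  split_ifs <;> omega

theorem FeasiblePred.exists_lt {g : ι → (ℕ → ℕ) → ℕ} {p : ι → (ℕ → ℕ) → ℕ → Prop}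
    (hg : Feasible I g) (hgv : PolyVal I g)
    (hp : FeasiblePred I fun k e => p k (fun j => e (j + 2)) (e 1)) :
    FeasiblePred I fun k e => ∃ i < g k e, p k e i :=
  FeasibleW.congr (FeasiblePred.exists_lt_weighted (fun _ => le_rfl) hg
    (by simpa [PolyVal] using hgv) hp) fun k e => by congr

theorem FeasiblePred.forall_lt {g : ι → (ℕ → ℕ) → ℕ} {p : ι → (ℕ → ℕ) → ℕ → Prop}
    (hg : Feasible I g) (hgv : PolyVal I g)
    (hp : FeasiblePred I fun k e => p k (fun j => e (j + 2)) (e 1)) :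
    FeasiblePred I fun k e => ∀ i < g k e, p k e i :=
  (FeasiblePred.exists_lt hg hgv (p := fun k e i => ¬ p k e i) hp.not).not.congr fun k e => by
    push Not
    rfl

/-! ### Counting, powers, and sets coded by binary expansions -/

theorem primRec_count (p : ℕ → Prop) [DecidablePred p] (m : ℕ) :
    primRec 0 (fun i acc => if p i then acc + 1 else acc) m = Nat.count p m := by
  induction m with
  | zero => simp [primRec]
  | succ m ih => by_cases h : p m <;> simp [primRec, ih, Nat.count_succ, h]

theorem FeasibleW.count {g : ι → (ℕ → ℕ) → ℕ} {p : ι → (ℕ → ℕ) → ℕ → Prop}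
    {_ : ∀ k e, DecidablePred (p k e)}
    (hg : Feasible I g) (hgv : PolyVal I g)
    (hp : FeasiblePred I fun k e => p k (fun j => e (j + 2)) (e 1)) :
    Feasible I fun k e => Nat.count (p k e) (g k e) := by
  refine (FeasibleW.primRec hg (feasible_const 0) (F := fun k e i acc =>
    if p k e i then acc + 1 else acc)
    (hp.ite ((feasible_var 0).add (feasible_const 1)) (feasible_var 0)) hgv fun _ => ?_).congr
      fun k e => (primRec_count _ _).symm
  obtain ⟨q, hq⟩ := hgv
  refine ⟨q, fun k e _ m hm => ?_⟩
  rw [primRec_count]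
  exact (((Nat.count_le _).trans hm).trans (hq k e)).trans_lt Nat.lt_two_pow_self

theorem FeasibleW.pow {g : ι → (ℕ → ℕ) → ℕ} (c : ℕ) (hg : Feasible I g) (hgv : PolyVal I g) :
    Feasible I fun k e => c ^ g k e := by
  have key (m : ℕ) : RAM.primRec 1 (fun _ acc => acc * c) m = c ^ m := by
    induction m with
    | zero => simp [RAM.primRec]
    | succ m ih => simp [RAM.primRec, ih, pow_succ]
  refine (FeasibleW.primRec hg (feasible_const 1) (F := fun _ _ _ acc => acc * c)
    ((feasible_var 0).mul (feasible_const c)) hgv fun _ => ?_).congr fun k e => (key _).symm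
  obtain ⟨q, hq⟩ := hgv
  refine ⟨c + q + 1, fun k e _ m hm => ?_⟩
  rw [key]
  calc c ^ m ≤ (2 ^ c) ^ m := Nat.pow_le_pow_left Nat.lt_two_pow_self.le m
    _ = 2 ^ (c * m) := (pow_mul ..).symm
    _ < 2 ^ I.size k ^ (c + q + 1) := by
      refine Nat.pow_lt_pow_right (by omega) ?_
      have h1 : c * m ≤ I.size k ^ (c + q) := by
        rw [pow_add]
        exact Nat.mul_le_mul (I.le_size_pow k c) (hm.trans (hq k e))
      have h2 := I.two_pow_mul_le k 1 (c + q)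
      have h3 := I.one_le_size_pow k (c + q)
      rw [add_comm 1] at h2
      omega

theorem testBit_add_two_pow {a m : ℕ} (ha : a < 2 ^ m) (i : ℕ) :
    (a + 2 ^ m).testBit i ↔ a.testBit i ∨ i = m := by
  rw [add_comm]
  rcases lt_trichotomy i m with h | rfl | h
  · simp [Nat.testBit_two_pow_add_gt h, h.ne]
  · simp [Nat.testBit_two_pow_add_eq, Nat.testBit_lt_two_pow ha]
  · have h1 : 2 ^ (m + 1) ≤ 2 ^ i := Nat.pow_le_pow_right (by omega) h
    rw [pow_succ] at h1
    simp [Nat.testBit_lt_two_pow (show 2 ^ m + a < 2 ^ i by omega),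
      Nat.testBit_lt_two_pow (show a < 2 ^ i by omega), h.ne']

/-- Membership in the subset of `{0, …, N - 1}` that the binary expansion of `x` codes. -/
def BitMem (N x i : ℕ) : Prop := i < N ∧ x.testBit i

theorem FeasiblePred.bitMem {g x i : ι → (ℕ → ℕ) → ℕ} (hg : Feasible I g) (hgv : PolyVal I g)
    (hx : Feasible I x) (hi : Feasible I i) :
    FeasiblePred I fun k e => BitMem (g k e) (x k e) (i k e) := by
  -- The exponent is capped because powers with large exponents are not feasible.
  refine ((FeasiblePred.lt hi hg).and (FeasiblePred.eq ((hx.div (FeasibleW.pow 2 (hi.min hg)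
    (hgv.of_le fun k e => Nat.min_le_right _ _))).mod (feasible_const 2))
      (feasible_const 1))).congr fun k e => ?_
  refine and_congr_right fun h => ?_
  rw [Nat.testBit_eq_decide_div_mod_eq, min_eq_left h.le, decide_eq_true_iff]

open Classical in
/-- The number whose binary expansion codes the set of all `i < N` that satisfy `p`. -/
noncomputable def bitSet (N : ℕ) (p : ℕ → Prop) : ℕ :=
  primRec 0 (fun i acc => if p i then acc + 2 ^ min i N else acc) N

open Classical in
theorem bitSet_aux (N : ℕ) (p : ℕ → Prop) {m : ℕ} (hm : m ≤ N) :
    primRec 0 (fun i acc => if p i then acc + 2 ^ min i N else acc) m < 2 ^ m ∧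
    ∀ i, (primRec 0 (fun i acc => if p i then acc + 2 ^ min i N else acc) m).testBit i ↔
      i < m ∧ p i := by
  induction m with
  | zero => simp [primRec]
  | succ m ih =>
    obtain ⟨h1, h2⟩ := ih (by omega)
    simp only [primRec, min_eq_left (show m ≤ N by omega)]
    by_cases h : p m
    · simp only [h, if_true]
      refine ⟨by rw [pow_succ]; omega, fun i => ?_⟩
      rw [testBit_add_two_pow h1, h2, Nat.lt_succ_iff_lt_or_eq]
      constructor
      · rintro (h' | rfl)
        · exact ⟨.inl h'.1, h'.2⟩
        · exact ⟨.inr rfl, h⟩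
      · rintro ⟨h' | rfl, h''⟩
        · exact .inl ⟨h', h''⟩
        · exact .inr rfl
    · simp only [h, if_false]
      refine ⟨by rw [pow_succ]; omega, fun i => ?_⟩
      rw [h2]
      refine ⟨fun h' => ⟨by omega, h'.2⟩, fun ⟨h', h''⟩ => ⟨?_, h''⟩⟩
      exact lt_of_le_of_ne (by omega) fun him => h (him ▸ h'')

theorem bitSet_lt (N : ℕ) (p : ℕ → Prop) : bitSet N p < 2 ^ N := (bitSet_aux N p le_rfl).1

theorem bitMem_bitSet {N : ℕ} {p : ℕ → Prop} {i : ℕ} :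
    BitMem N (bitSet N p) i ↔ i < N ∧ p i := by
  rw [BitMem, bitSet, (bitSet_aux N p le_rfl).2 i]
  tauto

theorem FeasibleW.bitSet {g : ι → (ℕ → ℕ) → ℕ} {p : ι → (ℕ → ℕ) → ℕ → Prop}
    (hg : Feasible I g) (hgv : PolyVal I g)
    (hp : FeasiblePred I fun k e => p k (fun j => e (j + 2)) (e 1)) :
    Feasible I fun k e => RAM.bitSet (g k e) (p k e) := by
  classical
  refine (FeasibleW.primRec hg (feasible_const 0) (F := fun k e i acc =>
    if p k e i then acc + 2 ^ Min.min i (g k e) else acc)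
    (hp.ite ((feasible_var 0).add (FeasibleW.pow 2 ((feasible_var 1).min (hg.rename (· + 2)))
      ?_)) (feasible_var 0)) hgv fun _ => ?_).congr fun k e => ?_
  · obtain ⟨q, hq⟩ := hgv
    exact ⟨q, fun k e => (Nat.min_le_right _ _).trans (hq _ _)⟩
  · obtain ⟨q, hq⟩ := hgv
    refine ⟨q, fun k e _ m hm => (bitSet_aux _ _ hm).1.trans_le ?_⟩
    exact Nat.pow_le_pow_right (by omega) (hm.trans (hq k e))
  · rfl

/-- Iteration of a feasible operation on numbers with polynomially many bits. -/
theorem FeasibleW.iterate {g a : ι → (ℕ → ℕ) → ℕ} {F : ι → (ℕ → ℕ) → ℕ → ℕ}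
    (hg : Feasible I g) (hgv : PolyVal I g) (ha : Feasible I a)
    (hF : Feasible I fun k e => F k (fun j => e (j + 2)) (e 0))
    (hFb : ∃ q, ∀ k e x, F k e x < 2 ^ I.size k ^ q) :
    Feasible I fun k e => (F k e)^[g k e] (a k e) := by
  have key (a : ℕ) (F : ℕ → ℕ) (m : ℕ) : RAM.primRec a (fun _ => F) m = F^[m] a := by
    induction m with
    | zero => simp [RAM.primRec]
    | succ m ih => simp [RAM.primRec, ih, Function.iterate_succ_apply']
  refine (FeasibleW.primRec hg ha (F := fun k e _ x => F k e x) hF hgv fun p => ?_).congr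
    fun k e => (key _ _ _).symm
  obtain ⟨q₁, h₁⟩ := ha.polyBits p
  obtain ⟨q₂, h₂⟩ := hFb
  refine ⟨q₁ + q₂, fun k e he m _ => ?_⟩
  cases m with
  | zero => exact (h₁ k e he).trans_le (I.two_pow_size_pow_mono k (by omega))
  | succ m => exact (h₂ k e _).trans_le (I.two_pow_size_pow_mono k (by omega))

end RAM

/-! ### Unit propagation for colourings with two admissible colours at each vertex -/

/-- Unit propagation for colourings of the natural numbers by the colours `0`, `1`, `2` in which
the colours of `Adj`-related vertices must not add up to `2`, so that each colour at a vertex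
excludes exactly one colour at its neighbours. `Excluded Adj X v q` says that colour `q` at vertex
`v` is excluded by the initial exclusions `X` or by a neighbour `u` all of whose colours except
`2 - q` have been excluded. -/
inductive Excluded (Adj : ℕ → ℕ → Prop) (X : ℕ → ℕ → Prop) : ℕ → ℕ → Prop
  | base {v q : ℕ} (h : X v q) : Excluded Adj X v q
  | unit {u v q : ℕ} (huv : Adj u v) (h : ∀ p < 3, p + q ≠ 2 → Excluded Adj X u p) :
      Excluded Adj X v q

namespace Excluded

variable {Adj : ℕ → ℕ → Prop} {X X' : ℕ → ℕ → Prop}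

theorem mono (h : ∀ v q, X v q → X' v q) {v q : ℕ} (hq : Excluded Adj X v q) :
    Excluded Adj X' v q := by
  induction hq with
  | base h' => exact .base (h _ _ h')
  | unit huv _ ih => exact .unit huv ih

/-- A solution that respects the initial exclusions respects all exclusions. -/
theorem ne_of_coloring {f : ℕ → ℕ} (hf : ∀ u v, Adj u v → f u < 3 ∧ f u + f v ≠ 2)
    (hX : ∀ v, ¬ X v (f v)) {v q : ℕ} (hq : Excluded Adj X v q) : q ≠ f v := by
  induction hq with
  | base h => exact fun h' => hX _ (h' ▸ h)
  | unit huv _ ih =>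
    rintro rfl
    exact ih _ (hf _ _ huv).1 (hf _ _ huv).2 rfl

/-- Suppose that propagation from `X` leaves at most two colours at each vertex. If every vertex
`v` has a colour `p` such that setting `v` to `p` and propagating leaves a colour at each vertex,
then there is a colouring that respects `X`.

The proof takes a maximal closed set `Y` of exclusions that leaves a colour at each vertex. If it
left two colours at `v`, then it could be enlarged by the exclusions `Z` that follow from setting
`v` to the colour `p`: at a vertex where `Y` leaves two colours, `Y` contains only consequences of
`X`, so `Z` extends `Y` there; at the other vertices, `Z` cannot exclude the only colour left. -/
theorem exists_coloring {n : ℕ} (hAdj : ∀ u v, Adj u v → u < n ∧ v < n)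
    (hsymm : ∀ u v, Adj u v → Adj v u)
    (htwo : ∀ v < n, ∃ q < 3, Excluded Adj X v q)
    (hset : ∀ v < n, ∃ p < 3, ∀ w < n, ∃ q < 3,
      ¬ Excluded Adj (fun w q => X w q ∨ w = v ∧ q ≠ p) w q) :
    ∃ f : ℕ → ℕ, (∀ w < n, f w < 3 ∧ ¬ X w (f w)) ∧ ∀ u v, Adj u v → f u + f v ≠ 2 := by
  classical
  rcases Nat.eq_zero_or_pos n with rfl | hn
  · exact ⟨fun _ => 0, by simp, fun u v h => absurd (hAdj u v h).1 (by omega)⟩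
  -- The closed sets of exclusions, as finite sets of pairs of a vertex and a colour.
  let Good (Y : Finset (ℕ × ℕ)) : Prop := Y ⊆ Finset.range n ×ˢ Finset.range 3 ∧
    (∀ v < n, ∀ q < 3, X v q → (v, q) ∈ Y) ∧
    (∀ u v q, Adj u v → q < 3 → (∀ p < 3, p + q ≠ 2 → (u, p) ∈ Y) → (v, q) ∈ Y) ∧
    ∀ v < n, ∃ q < 3, (v, q) ∉ Y
  let clo (X : ℕ → ℕ → Prop) : Finset (ℕ × ℕ) :=
    (Finset.range n ×ˢ Finset.range 3).filter fun a => Excluded Adj X a.1 a.2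
  have mem_clo {X : ℕ → ℕ → Prop} {v q : ℕ} :
      (v, q) ∈ clo X ↔ (v < n ∧ q < 3) ∧ Excluded Adj X v q := by simp [clo]
  have good_clo (v p : ℕ) (h : ∀ w < n, ∃ q < 3,
      ¬ Excluded Adj (fun w q => X w q ∨ w = v ∧ q ≠ p) w q) :
      Good (clo fun w q => X w q ∨ w = v ∧ q ≠ p) := by
    refine ⟨Finset.filter_subset _ _, fun w hw q hq hX => mem_clo.2 ⟨⟨hw, hq⟩, .base (.inl hX)⟩,
      fun u w q huw hq hp => mem_clo.2 ⟨⟨(hAdj _ _ huw).2, hq⟩, .unit huw fun p hp3 hpq =>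
        (mem_clo.1 (hp p hp3 hpq)).2⟩, fun w hw => ?_⟩
    obtain ⟨q, hq, h⟩ := h w hw
    exact ⟨q, hq, fun h' => h (mem_clo.1 h').2⟩
  have hfin : {Y | Good Y}.Finite :=
    ((Finset.range n ×ˢ Finset.range 3).powerset.finite_toSet).subset fun Y hY =>
      Finset.mem_coe.2 (Finset.mem_powerset.2 hY.1)
  obtain ⟨Y, hY, hmax⟩ : ∃ Y, Good Y ∧ ∀ Y', Good Y' → Y ⊆ Y' → Y' = Y := by
    obtain ⟨p, -, h⟩ := hset 0 hn
    obtain ⟨Y, hY⟩ := hfin.exists_maximal ⟨_, good_clo 0 p h⟩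
    exact ⟨Y, hY.1, fun Y' h' hle => (hY.2 h' hle).antisymm hle⟩
  obtain ⟨hYr, hYX, hYc, hYn⟩ := hY
  -- `Y` contains the consequences of `X`.
  have hYE {v q : ℕ} (h : Excluded Adj X v q) (hv : v < n) (hq : q < 3) : (v, q) ∈ Y := by
    induction h with
    | base h => exact hYX _ hv _ hq h
    | unit huv _ ih => exact hYc _ _ _ huv hq fun p hp hpq => ih p hp hpq (hAdj _ _ huv).1 hp
  choose! f hf3 hfY using hYn
  by_cases hdet : ∀ v < n, ∀ q < 3, q ≠ f v → (v, q) ∈ Y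
  · refine ⟨f, fun w hw => ⟨hf3 w hw, fun h => hfY w hw (hYX w hw _ (hf3 w hw) h)⟩,
      fun u v huv h => ?_⟩
    obtain ⟨hu, hv⟩ := hAdj u v huv
    exact hfY v hv (hYc u v _ huv (hf3 v hv) fun p hp hpq => hdet u hu p hp (by omega))
  exfalso
  push Not at hdet
  obtain ⟨v, hv, p₀, hp₀, hne, hp₀Y⟩ := hdet
  obtain ⟨p, hp, hZ⟩ := hset v hv
  set X' : ℕ → ℕ → Prop := fun w q => X w q ∨ w = v ∧ q ≠ p with hX'
  obtain ⟨-, hZX, hZc, hZn⟩ := good_clo v p hZ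
  set Z := clo X'
  -- At the vertices where `Y` leaves two colours, `Y` is contained in `Z`.
  have hYZ {w a b : ℕ} (hw : w < n) (hab : a ≠ b) (ha : a < 3) (hb : b < 3) (haY : (w, a) ∉ Y)
      (hbY : (w, b) ∉ Y) {q : ℕ} (hq : (w, q) ∈ Y) : (w, q) ∈ Z := by
    obtain ⟨c, hc, hcE⟩ := htwo w hw
    have hcY := hYE hcE hw hc
    have hca : c ≠ a := fun h => haY (h ▸ hcY)
    have hcb : c ≠ b := fun h => hbY (h ▸ hcY)
    have hqa : q ≠ a := fun h => haY (h ▸ hq)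
    have hqb : q ≠ b := fun h => hbY (h ▸ hq)
    have hq3 : q < 3 := by simpa [hw] using hYr hq
    obtain rfl : q = c := by omega
    exact mem_clo.2 ⟨⟨hw, hc⟩, hcE.mono fun _ _ => .inl⟩
  -- At the other vertices, `Z` does not exclude the only colour that `Y` leaves.
  have hZY {w c : ℕ} (hE : Excluded Adj X' w c) (hw : w < n) (hc : c < 3)
      (hdet : ∀ q < 3, q ≠ c → (w, q) ∈ Y) : (w, c) ∈ Y := by
    induction hE with
    | @base w q h =>
      rcases h with h | ⟨rfl, -⟩
      · exact hYX _ hw _ hc h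
      · -- `Y` leaves two colours at `v`.
        exfalso
        have h1 : f w = q := by
          by_contra h1
          exact hfY w hw (hdet _ (hf3 w hw) h1)
        exact hp₀Y (hdet p₀ hp₀ (h1 ▸ hne))
    | @unit u w q huw hEx ih =>
      have hu := (hAdj _ _ huw).1
      have h2q : (u, 2 - q) ∈ Y := hYc _ _ _ (hsymm _ _ huw) (by omega) fun r hr hrq =>
        hdet r hr (by omega)
      by_contra hqY
      have hfu : f u ≠ 2 - q := fun h => hfY u hu (h ▸ h2q)
      by_cases hudet : ∀ r < 3, r ≠ f u → (u, r) ∈ Y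
      · exact hfY u hu (ih (f u) (hf3 u hu) (by omega) hu (hf3 u hu) hudet)
      · push Not at hudet
        obtain ⟨r, hr, hrf, hrY⟩ := hudet
        have h1 := hYZ hu hrf hr (hf3 u hu) hrY (hfY u hu) h2q
        obtain ⟨s, hs, hsZ⟩ := hZn u hu
        by_cases hsq : s + q = 2
        · exact hsZ ((show s = 2 - q by omega) ▸ h1)
        · exact hsZ (mem_clo.2 ⟨⟨hu, hs⟩, hEx s hs hsq⟩)
  have hgood : Good (Y ∪ Z) := by
    have hcases (w : ℕ) (hw : w < n) : (∀ q, (w, q) ∈ Y ∪ Z → (w, q) ∈ Y) ∨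
        (∀ q, (w, q) ∈ Y ∪ Z → (w, q) ∈ Z) := by
      by_cases hwdet : ∀ r < 3, r ≠ f w → (w, r) ∈ Y
      · refine .inl fun q hq => (Finset.mem_union.1 hq).elim id fun hq => ?_
        obtain ⟨⟨-, hq3⟩, hq⟩ := mem_clo.1 hq
        by_cases hqf : q = f w
        · exact hZY hq hw hq3 (hqf ▸ hwdet)
        · exact hwdet q hq3 hqf
      · push Not at hwdet
        obtain ⟨r, hr, hrf, hrY⟩ := hwdet
        exact .inr fun q hq => (Finset.mem_union.1 hq).elim
          (hYZ hw hrf hr (hf3 w hw) hrY (hfY w hw)) id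
    refine ⟨Finset.union_subset hYr (Finset.filter_subset _ _), fun w hw q hq hX =>
      Finset.mem_union_left _ (hYX w hw q hq hX), fun u w q huw hq h => ?_, fun w hw => ?_⟩
    · rcases hcases u (hAdj _ _ huw).1 with h' | h'
      · exact Finset.mem_union_left _ (hYc u w q huw hq fun r hr hrq => h' r (h r hr hrq))
      · exact Finset.mem_union_right _ (hZc u w q huw hq fun r hr hrq => h' r (h r hr hrq))
    · rcases hcases w hw with h' | h'
      · exact ⟨f w, hf3 w hw, fun h => hfY w hw (h' _ h)⟩
      · obtain ⟨q, hq, hqZ⟩ := hZn w hw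
        exact ⟨q, hq, fun h => hqZ (h' _ h)⟩
  have hYZeq := hmax _ hgood Finset.subset_union_left
  -- One of the two colours that `Y` leaves at `v` is not `p`, so it lies in `Z`.
  have hmemY {q : ℕ} (hq : q < 3) (hqp : q ≠ p) : (v, q) ∈ Y := by
    rw [← hYZeq]
    exact Finset.mem_union_right _ (mem_clo.2 ⟨⟨hv, hq⟩, .base (.inr ⟨rfl, hqp⟩)⟩)
  by_cases h : p₀ = p
  · exact hfY v hv (hmemY (hf3 v hv) fun h' => hne (h.trans h'.symm))
  · exact hp₀Y (hmemY hp₀ h)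

end Excluded

open RAM

namespace SimpleGraph

/-! ### Colourings and independent cutsets -/

/-- The adjacency relation of a graph with vertices `0, …, n - 1`, as a relation on `ℕ`. -/
def NatAdj {n : ℕ} (G : SimpleGraph (Fin n)) (u v : ℕ) : Prop :=
  ∃ (hu : u < n) (hv : v < n), G.Adj ⟨u, hu⟩ ⟨v, hv⟩

/-- An independent cutset is the same as a colouring in which the colours `0` and `2` occur and
stand for the two sides, and colour `1` stands for the cutset: adjacent vertices must not be
coloured `0` and `2`, nor both `1`. -/
theorem hasIndepCutset_iff {n : ℕ} (G : SimpleGraph (Fin n)) :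
    G.HasIndepCutset ↔ ∃ f : ℕ → ℕ, (∀ v < n, f v < 3) ∧
      (∀ u v, G.NatAdj u v → f u + f v ≠ 2) ∧ (∃ a < n, f a = 0) ∧ ∃ b < n, f b = 2 := by
  classical
  constructor
  · rintro ⟨S, hS, hcut⟩
    simp only [IsCutset, Preconnected, not_forall] at hcut
    obtain ⟨a, b, hab⟩ := hcut
    let f (v : ℕ) : ℕ :=
      if hv : v < n then
        if h : ⟨v, hv⟩ ∈ S then 1
        else if (G.induce Sᶜ).Reachable a ⟨⟨v, hv⟩, Set.mem_compl h⟩ then 0 else 2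
      else 0
    have key (u v : ℕ) (h : G.NatAdj u v) : f u = 0 → f v ≠ 2 := by
      obtain ⟨hu, hv, huv⟩ := h
      simp only [f, hu, hv, dif_pos]
      split_ifs <;> simp
      next hr _ hnr =>
        refine hnr (hr.trans (Adj.reachable ?_))
        exact huv
    refine ⟨f, fun v hv => ?_, fun u v huv h => ?_, ⟨a.1, a.1.2, ?_⟩, ⟨b.1, b.1.2, ?_⟩⟩
    · simp only [f]
      split_ifs <;> omega
    · have h0 : f u = 0 ∧ f v = 2 ∨ f v = 0 ∧ f u = 2 ∨ f u = 1 ∧ f v = 1 := by omega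
      rcases h0 with ⟨h1, h2⟩ | ⟨h1, h2⟩ | ⟨h1, h2⟩
      · exact key u v huv h1 h2
      · obtain ⟨hu, hv, huv⟩ := huv
        exact key v u ⟨hv, hu, huv.symm⟩ h1 h2
      · obtain ⟨hu, hv, huv⟩ := huv
        have mem (w : ℕ) (hw : w < n) (h : f w = 1) : (⟨w, hw⟩ : Fin n) ∈ S := by
          by_contra hwS
          simp only [f, hw, hwS, dif_pos, dif_neg, not_false_eq_true] at h
          split_ifs at h
          omega
        exact hS (mem u hu h1) (mem v hv h2) huv.ne huv
    · simp only [f, a.1.2, dif_pos, Fin.eta]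
      rw [dif_neg a.2, if_pos (Reachable.refl _)]
    · simp only [f, b.1.2, dif_pos, Fin.eta]
      rw [dif_neg b.2, if_neg hab]
  · rintro ⟨f, hf3, hf, ⟨a, ha, hfa⟩, b, hb, hfb⟩
    refine ⟨{v | f v = 1}, fun u hu v hv _ huv => hf u v ⟨u.2, v.2, huv⟩ ?_, fun h => ?_⟩
    · simp only [Set.mem_ofPred_eq] at hu hv
      omega
    · obtain ⟨p⟩ := h ⟨⟨a, ha⟩, by simp [hfa]⟩ ⟨⟨b, hb⟩, by simp [hfb]⟩
      have key : ∀ (x y : ({v : Fin n | f v = 1}ᶜ : Set (Fin n)))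
          (_ : (G.induce {v : Fin n | f v = 1}ᶜ).Walk x y), f x.1 = 0 → f y.1 = 0 := by
        intro x y p
        induction p with
        | nil => exact id
        | @cons x z y hxz _ ih =>
          intro hx
          refine ih ?_
          have h1 := hf x.1 z.1 ⟨x.1.2, z.1.2, by simpa using hxz⟩
          have h2 := hf3 z.1 z.1.2
          have h3 : f z.1 ≠ 1 := z.2
          omega
      have := key _ _ p hfa
      simp_all

/-! ### The search for a colouring -/

open Classical in
/-- The greedy maximal independent set among the vertices below `m`, as a binary expansion. -/
noncomputable def greedySet (n : ℕ) (Adj : ℕ → ℕ → Prop) (m : ℕ) : ℕ :=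
  primRec 0 (fun v D => if ∃ u < n, BitMem n D u ∧ Adj u v then D else D + 2 ^ min v n) m

open Classical in
/-- The colour that the number `m` assigns to the vertex `v` in the set coded by `D`: the digit of
`m` in base `3` whose position is the number of smaller elements of that set. -/
noncomputable def digitColor (n D m v : ℕ) : ℕ :=
  m / 3 ^ Nat.count (fun u => u < v ∧ BitMem n D u) n % 3

/-- The colours that are excluded if the vertices of the set coded by `D` are coloured according to
`m`, vertex `a` gets colour `0`, and vertex `b` gets colour `2`. -/
def InitExcl (n D m a b w q : ℕ) : Prop :=
  (BitMem n D w ∧ q ≠ digitColor n D m w) ∨ (w = a ∧ q ≠ 0) ∨ (w = b ∧ q ≠ 2)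

/-- One round of unit propagation. Bit `3 * v + q` says that colour `q` is excluded at `v`. -/
noncomputable def propStep (n : ℕ) (Adj : ℕ → ℕ → Prop) (Y : ℕ) : ℕ :=
  bitSet (3 * n) fun i => BitMem (3 * n) Y i ∨
    ∃ u < n, Adj u (i / 3) ∧ ∀ p < 3, p + i % 3 ≠ 2 → BitMem (3 * n) Y (3 * u + p)

/-- Unit propagation from the initial exclusions `X`. -/
noncomputable def propagate (n : ℕ) (Adj : ℕ → ℕ → Prop) (X : ℕ → ℕ → Prop) : ℕ :=
  (propStep n Adj)^[3 * n] (bitSet (3 * n) fun i => X (i / 3) (i % 3))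

/-- The test for a colouring that respects `InitExcl n D m a b`. -/
def Extends (n : ℕ) (Adj : ℕ → ℕ → Prop) (D m a b : ℕ) : Prop :=
  ∀ v < n, ∃ p < 3, ∀ w < n, ∃ q < 3, ¬ BitMem (3 * n)
    (propagate n Adj fun w q => InitExcl n D m a b w q ∨ w = v ∧ q ≠ p) (3 * w + q)

theorem bitMem_propagate {n : ℕ} {Adj X : ℕ → ℕ → Prop} (hAdj : ∀ u v, Adj u v → u < n)
    {v q : ℕ} (hv : v < n) (hq : q < 3) :
    BitMem (3 * n) (propagate n Adj X) (3 * v + q) ↔ Excluded Adj X v q := by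
  classical
  set Y : ℕ → ℕ := fun j => (propStep n Adj)^[j] (bitSet (3 * n) fun i => X (i / 3) (i % 3))
  have hsucc (j : ℕ) : Y (j + 1) = propStep n Adj (Y j) := Function.iterate_succ_apply' ..
  have hmono {j i : ℕ} (h : BitMem (3 * n) (Y j) i) : BitMem (3 * n) (Y (j + 1)) i := by
    rw [hsucc, propStep, bitMem_bitSet]
    exact ⟨h.1, .inl h⟩
  let S (j : ℕ) : Finset ℕ := (Finset.range (3 * n)).filter (BitMem (3 * n) (Y j))
  have hS (j : ℕ) : S j ⊆ S (j + 1) := fun i hi => by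
    simp only [S, Finset.mem_filter] at hi ⊢
    exact ⟨hi.1, hmono hi.2⟩
  have hmem {j j' : ℕ} (h : S j = S j') (i : ℕ) :
      BitMem (3 * n) (Y j) i ↔ BitMem (3 * n) (Y j') i := by
    have h1 : i ∈ S j ↔ i ∈ S j' := by rw [h]
    simp only [S, Finset.mem_filter, Finset.mem_range] at h1
    exact ⟨fun h => (h1.1 ⟨h.1, h⟩).2, fun h => (h1.2 ⟨h.1, h⟩).2⟩
  -- The increasing sequence of sets is stationary from its `3 * n`-th member on.
  have hstab : S (3 * n + 1) = S (3 * n) := by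
    refine (Finset.eq_of_subset_of_card_le (hS _) (le_of_eq ?_)).symm
    refine Nat.stabilises_of_monotone (f := fun j => (S j).card)
      (monotone_nat_of_le_succ fun j => Finset.card_le_card (hS j))
      (fun j => (Finset.card_filter_le _ _).trans_eq (Finset.card_range _)) (fun j hj => ?_)
      (Nat.le_succ _)
    have h1 := Finset.eq_of_subset_of_card_le (hS j) hj.ge
    have h2 : Y (j + 2) = Y (j + 1) := by
      rw [hsucc (j + 1)]
      refine Eq.trans ?_ (hsucc j).symm
      simp only [propStep, hmem h1]
    simp only [S, h2]
  have hfix (i : ℕ) : BitMem (3 * n) (Y (3 * n + 1)) i ↔ BitMem (3 * n) (Y (3 * n)) i :=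
    hmem hstab i
  have hsound : ∀ j i, BitMem (3 * n) (Y j) i → Excluded Adj X (i / 3) (i % 3) := by
    intro j
    induction j with
    | zero => exact fun i h => .base (bitMem_bitSet.1 h).2
    | succ j ih =>
      intro i h
      rw [hsucc, propStep, bitMem_bitSet] at h
      rcases h.2 with h | ⟨u, -, hu, h⟩
      · exact ih i h
      · refine .unit hu fun p hp hpi => ?_
        have := ih _ (h p hp hpi)
        rwa [show (3 * u + p) / 3 = u by omega, show (3 * u + p) % 3 = p by omega] at this
  have hbase {i : ℕ} (hi : i < 3 * n) (hX : X (i / 3) (i % 3)) (j : ℕ) :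
      BitMem (3 * n) (Y j) i := by
    induction j with
    | zero => exact bitMem_bitSet.2 ⟨hi, hX⟩
    | succ j ih => exact hmono ih
  change BitMem (3 * n) (Y (3 * n)) _ ↔ _
  refine ⟨fun h => ?_, fun h => ?_⟩
  · have := hsound _ _ h
    rwa [show (3 * v + q) / 3 = v by omega, show (3 * v + q) % 3 = q by omega] at this
  · induction h with
    | @base v q h =>
      refine hbase (by omega) ?_ _
      rwa [show (3 * v + q) / 3 = v by omega, show (3 * v + q) % 3 = q by omega]
    | @unit u v q huv _ ih =>
      rw [← hfix, hsucc, propStep, bitMem_bitSet]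
      refine ⟨by omega, .inr ⟨u, hAdj _ _ huv, ?_, fun p hp hpq => ih p hp ?_ (hAdj _ _ huv) hp⟩⟩
      · rwa [show (3 * v + q) / 3 = v by omega]
      · omega

theorem greedySet_spec {n : ℕ} {Adj : ℕ → ℕ → Prop} (hsymm : ∀ u v, Adj u v → Adj v u)
    (hirr : ∀ u, ¬ Adj u u) {m : ℕ} (hm : m ≤ n) :
    greedySet n Adj m < 2 ^ m ∧
    (∀ u v, BitMem n (greedySet n Adj m) u → BitMem n (greedySet n Adj m) v → ¬ Adj u v) ∧
    ∀ v < m, BitMem n (greedySet n Adj m) v ∨ ∃ u, BitMem n (greedySet n Adj m) u ∧ Adj u v := by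
  classical
  induction m with
  | zero => simp [greedySet, primRec, BitMem]
  | succ m ih =>
    obtain ⟨h1, h2, h3⟩ := ih (by omega)
    set D := greedySet n Adj m
    have hsucc : greedySet n Adj (m + 1) =
        if ∃ u < n, BitMem n D u ∧ Adj u m then D else D + 2 ^ m := by
      rw [greedySet, primRec, min_eq_left (by omega)]
      rfl
    rw [hsucc]
    split_ifs with h
    · refine ⟨by rw [pow_succ]; omega, h2, fun v hv => ?_⟩
      rcases Nat.lt_succ_iff_lt_or_eq.1 hv with hv | rfl
      · exact h3 v hv
      · obtain ⟨u, -, hu⟩ := h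
        exact .inr ⟨u, hu⟩
    · have hmem (i : ℕ) : BitMem n (D + 2 ^ m) i ↔ BitMem n D i ∨ i = m := by
        rw [BitMem, testBit_add_two_pow h1, BitMem]
        constructor
        · tauto
        · rintro (h | rfl)
          · exact ⟨h.1, .inl h.2⟩
          · exact ⟨by omega, .inr rfl⟩
      have hnot (u : ℕ) (hu : BitMem n D u) : ¬ Adj u m := fun hum => h ⟨u, hu.1, hu, hum⟩
      refine ⟨by rw [pow_succ]; omega, fun u v hu hv huv => ?_, fun v hv => ?_⟩
      · rcases (hmem u).1 hu with hu | rfl <;> rcases (hmem v).1 hv with hv | rfl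
        · exact h2 u v hu hv huv
        · exact hnot u hu huv
        · exact hnot v hv (hsymm _ _ huv)
        · exact hirr _ huv
      · simp only [hmem]
        rcases Nat.lt_succ_iff_lt_or_eq.1 hv with hv | rfl
        · exact (h3 v hv).imp .inl fun ⟨u, hu, huv⟩ => ⟨u, .inl hu, huv⟩
        · exact .inl (.inr rfl)

/-- Every sequence of digits in base `3`, indexed by the elements of a set, is that of a number. -/
theorem exists_digits (p : ℕ → Prop) [DecidablePred p] {f : ℕ → ℕ} {M : ℕ}
    (hf : ∀ v < M, f v < 3) :
    ∃ m < 3 ^ Nat.count p M, ∀ v < M, p v → m / 3 ^ Nat.count p v % 3 = f v := by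
  induction M with
  | zero => exact ⟨0, by simp⟩
  | succ M ih =>
    obtain ⟨m, hm, h⟩ := ih fun v hv => hf v (by omega)
    by_cases hM : p M
    · refine ⟨m + 3 ^ Nat.count p M * f M, ?_, fun v hv hpv => ?_⟩
      · rw [Nat.count_succ, if_pos hM, pow_succ]
        have := Nat.mul_le_mul_left (3 ^ Nat.count p M) (Nat.le_of_lt_succ (hf M (by omega)))
        omega
      · rcases Nat.lt_succ_iff_lt_or_eq.1 hv with hv | rfl
        · obtain ⟨c, hc⟩ := Nat.exists_eq_add_of_lt (Nat.count_strict_mono hpv hv)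
          rw [hc, show 3 ^ (Nat.count p v + c + 1) * f M =
            3 ^ Nat.count p v * (3 * (3 ^ c * f M)) by ring,
            Nat.add_mul_div_left _ _ (by positivity), Nat.add_mul_mod_self_left, h v hv hpv]
        · rw [Nat.add_mul_div_left _ _ (by positivity), Nat.div_eq_of_lt hm, zero_add,
            Nat.mod_eq_of_lt (hf v hv)]
    · refine ⟨m, by rwa [Nat.count_succ, if_neg hM, add_zero], fun v hv hpv => ?_⟩
      rcases Nat.lt_succ_iff_lt_or_eq.1 hv with hv | rfl
      · exact h v hv hpv
      · exact absurd hpv hM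

open Classical in
theorem digitColor_eq {n D m v : ℕ} (hv : v ≤ n) :
    digitColor n D m v = m / 3 ^ Nat.count (BitMem n D) v % 3 := by
  rw [digitColor]
  congr 3
  rw [Nat.count_eq_card_filter_range, Nat.count_eq_card_filter_range]
  congr 1
  ext u
  simp only [Finset.mem_filter, Finset.mem_range]
  exact ⟨fun h => h.2, fun h => ⟨by omega, h⟩⟩

theorem natAdj_symm {n : ℕ} (G : SimpleGraph (Fin n)) (u v : ℕ) (h : G.NatAdj u v) :
    G.NatAdj v u := by
  obtain ⟨hu, hv, h⟩ := h
  exact ⟨hv, hu, h.symm⟩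

theorem not_natAdj_self {n : ℕ} (G : SimpleGraph (Fin n)) (u : ℕ) : ¬ G.NatAdj u u :=
  fun ⟨_, _, h⟩ => h.ne rfl

open Classical in
/-- The greedy independent set is dominating, so a colouring of it leaves at most two colours at
every vertex. Hence the search through its colourings finds an independent cutset if there is
one. -/
theorem hasIndepCutset_iff_exists_lt {n : ℕ} (G : SimpleGraph (Fin n)) :
    G.HasIndepCutset ↔
      ∃ j < 3 ^ Nat.count (BitMem n (greedySet n G.NatAdj n)) n * (n * n),
        Extends n G.NatAdj (greedySet n G.NatAdj n) (j / (n * n)) (j / n % n) (j % n) := by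
  obtain ⟨-, -, hdom⟩ := greedySet_spec G.natAdj_symm G.not_natAdj_self le_rfl
  set D := greedySet n G.NatAdj n
  rw [hasIndepCutset_iff]
  constructor
  · rintro ⟨f, hf3, hf, ⟨a, ha, hfa⟩, b, hb, hfb⟩
    obtain ⟨m, hm, hmf⟩ := exists_digits (BitMem n D) hf3
    have hab : a * n + b < n * n := by
      calc a * n + b < a * n + n := by omega
        _ = (a + 1) * n := by ring
        _ ≤ n * n := Nat.mul_le_mul_right _ ha
    refine ⟨m * (n * n) + (a * n + b), ?_, ?_⟩
    · calc m * (n * n) + (a * n + b) < m * (n * n) + n * n := by omega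
        _ = (m + 1) * (n * n) := by ring
        _ ≤ _ := Nat.mul_le_mul_right _ hm
    have h1 : (m * (n * n) + (a * n + b)) / (n * n) = m := by
      rw [Nat.add_comm, Nat.add_mul_div_right _ _ (by omega), Nat.div_eq_of_lt hab, zero_add]
    have h2 : (m * (n * n) + (a * n + b)) % n = b := by
      rw [show m * (n * n) + (a * n + b) = b + n * (m * n + a) by ring, Nat.add_mul_mod_self_left,
        Nat.mod_eq_of_lt hb]
    have h3 : (m * (n * n) + (a * n + b)) / n % n = a := by
      rw [show m * (n * n) + (a * n + b) = b + n * (a + n * m) by ring,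
        Nat.add_mul_div_left _ _ (by omega), Nat.div_eq_of_lt hb, zero_add,
        Nat.add_mul_mod_self_left, Nat.mod_eq_of_lt ha]
    rw [h1, h2, h3]
    refine fun v hv => ⟨f v, hf3 v hv, fun w hw => ⟨f w, hf3 w hw, ?_⟩⟩
    rw [bitMem_propagate (fun _ _ h => h.1) hw (hf3 w hw)]
    refine fun hE => Excluded.ne_of_coloring (fun u w h => ⟨hf3 u h.1, hf u w h⟩) ?_ hE rfl
    rintro u ((⟨hu, h⟩ | ⟨rfl, h⟩ | ⟨rfl, h⟩) | ⟨rfl, h⟩)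
    · rw [digitColor_eq hu.1.le] at h
      exact h (hmf u hu.1 hu).symm
    · exact h hfa
    · exact h hfb
    · exact h rfl
  · rintro ⟨j, hj, hext⟩
    have hn : 0 < n := by
      rcases Nat.eq_zero_or_pos n with rfl | hn
      · simp at hj
      · exact hn
    set m := j / (n * n)
    set a := j / n % n with ha
    set b := j % n with hb
    have han : a < n := Nat.mod_lt _ hn
    have hbn : b < n := Nat.mod_lt _ hn
    have htwo : ∀ v < n, ∃ q < 3, Excluded G.NatAdj (InitExcl n D m a b) v q := by
      intro v hv
      have hc (u : ℕ) : digitColor n D m u < 3 := Nat.mod_lt _ (by omega)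
      rcases hdom v hv with hvD | ⟨u, huD, huv⟩
      · refine ⟨if digitColor n D m v = 0 then 1 else 0, by split_ifs <;> omega,
          .base (.inl ⟨hvD, ?_⟩)⟩
        split_ifs <;> omega
      · refine ⟨2 - digitColor n D m u, by omega, .unit huv fun p hp hpq => .base (.inl ⟨huD, ?_⟩)⟩
        have := hc u
        omega
    have hset : ∀ v < n, ∃ p < 3, ∀ w < n, ∃ q < 3, ¬ Excluded G.NatAdj
        (fun w q => InitExcl n D m a b w q ∨ w = v ∧ q ≠ p) w q := by
      intro v hv
      obtain ⟨p, hp, h⟩ := hext v hv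
      refine ⟨p, hp, fun w hw => ?_⟩
      obtain ⟨q, hq, h⟩ := h w hw
      exact ⟨q, hq, fun hE => h ((bitMem_propagate (fun _ _ h => h.1) hw hq).2 hE)⟩
    obtain ⟨f, hf, hfadj⟩ := Excluded.exists_coloring (fun u v h => ⟨h.1, h.2.1⟩)
      G.natAdj_symm htwo hset
    refine ⟨f, fun v hv => (hf v hv).1, hfadj, ⟨a, han, ?_⟩, b, hbn, ?_⟩
    · by_contra h
      exact (hf a han).2 (.inr (.inl ⟨rfl, h⟩))
    · by_contra h
      exact (hf b hbn).2 (.inr (.inr ⟨rfl, h⟩))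

open Classical in
theorem count_greedySet_le {n : ℕ} (G : SimpleGraph (Fin n)) :
    Nat.count (BitMem n (greedySet n G.NatAdj n)) n ≤ G.indepNum := by
  obtain ⟨-, hind, -⟩ := greedySet_spec G.natAdj_symm G.not_natAdj_self le_rfl
  set D := greedySet n G.NatAdj n
  have h : G.IsIndepSet (Finset.univ.filter fun v : Fin n => BitMem n D v : Finset (Fin n)) := by
    intro u hu v hv _ huv
    simp only [Finset.coe_filter, Finset.mem_univ, true_and, Set.mem_ofPred_eq] at hu hv
    exact hind u v hu hv ⟨u.2, v.2, huv⟩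
  refine le_trans (le_of_eq ?_) h.card_le_indepNum
  rw [Nat.count_eq_card_filter_range, ← Finset.card_map Fin.valEmbedding]
  congr 1
  ext v
  simp only [Finset.mem_filter, Finset.mem_range, Finset.mem_map, Finset.mem_univ, true_and,
    Fin.valEmbedding_apply]
  exact ⟨fun h => ⟨⟨v, h.1⟩, h.2, rfl⟩, fun ⟨u, hu, huv⟩ => huv ▸ ⟨u.2, hu⟩⟩

/-! ### The search on the machine -/

theorem inputArray_zero {n : ℕ} (G : SimpleGraph (Fin n)) : G.inputArray 0 = n := by
  simp [inputArray]

theorem inputArray_eq_one_iff {n : ℕ} (G : SimpleGraph (Fin n)) {u v : ℕ} (hv : v < n) :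
    G.inputArray (1 + u * n + v) = 1 ↔ G.NatAdj u v := by
  rw [inputArray, if_neg (by omega)]
  constructor
  · intro h
    split_ifs at h with h'
    obtain ⟨i, j, hij, hadj⟩ := h'
    have hn : 0 < n := by omega
    have h1 : v + n * u = j + n * i := by linarith
    have h2 : v = j := by
      have := congrArg (· % n) h1
      simpa [Nat.mod_eq_of_lt hv, Nat.mod_eq_of_lt j.2] using this
    have h3 : u = i := by
      have := congrArg (· / n) h1
      simpa [Nat.add_mul_div_left _ _ hn, Nat.div_eq_of_lt hv, Nat.div_eq_of_lt j.2] using this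
    subst h2 h3
    exact ⟨i.2, j.2, hadj⟩
  · rintro ⟨hu, hv, h⟩
    exact if_pos ⟨⟨u, hu⟩, ⟨v, hv⟩, rfl, h⟩

/-- The graphs with vertices `0, …, n - 1`, for all `n`. -/
abbrev GraphInput : Type := Σ n, SimpleGraph (Fin n)

/-- The input arrays of the graphs with vertices `0, …, n - 1`. -/
noncomputable def inputFamily : InputFamily GraphInput where
  cell k := k.2.inputArray
  size k := k.1 + 2
  two_le_size k := by omega
  cell_le_size k a := by
    rw [inputArray]
    split_ifs <;> omega

theorem feasible_order : Feasible inputFamily fun k _ => k.1 :=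
  (feasible_const 0).cell.congr fun k _ => k.2.inputArray_zero.symm

theorem polyVal_order : PolyVal inputFamily fun k _ => k.1 :=
  (PolyVal.cell (I := inputFamily) fun _ _ => 0).of_le fun k _ => k.2.inputArray_zero.ge

theorem feasible_three_mul_order : Feasible inputFamily fun k _ => 3 * k.1 :=
  (feasible_const 3).mul feasible_order

theorem polyVal_three_mul_order : PolyVal inputFamily fun k _ => 3 * k.1 :=
  (polyVal_const 3).mul polyVal_order

theorem feasiblePred_natAdj {u v : GraphInput → (ℕ → ℕ) → ℕ}
    (hu : Feasible inputFamily u) (hv : Feasible inputFamily v) :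
    FeasiblePred inputFamily fun k e => k.2.NatAdj (u k e) (v k e) :=
  ((FeasiblePred.lt hv feasible_order).and (FeasiblePred.eq
    (((feasible_const 1).add (hu.mul feasible_order)).add hv).cell (feasible_const 1))).congr
      fun k _ => ⟨fun h => ⟨h.2.1, (k.2.inputArray_eq_one_iff h.2.1).2 h⟩,
        fun h => (k.2.inputArray_eq_one_iff h.1).1 h.2⟩

theorem feasible_greedySet :
    Feasible inputFamily fun k _ => greedySet k.1 k.2.NatAdj k.1 := by
  classical
  refine FeasibleW.congr (FeasibleW.primRec feasible_order (feasible_const 0)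
    (F := fun k _ v D => if ∃ u < k.1, BitMem k.1 D u ∧ k.2.NatAdj u v then D
      else D + 2 ^ min v k.1) (FeasiblePred.ite (.exists_lt feasible_order polyVal_order
        (p := fun k e u => BitMem k.1 (e 0) u ∧ k.2.NatAdj u (e 1))
        (.and (.bitMem feasible_order polyVal_order (feasible_var 2) (feasible_var 1))
          (feasiblePred_natAdj (feasible_var 1) (feasible_var 3))))
        (feasible_var 0) (.add (feasible_var 0) (.pow 2 (.min (feasible_var 1) feasible_order)
          (polyVal_order.of_le fun _ _ => Nat.min_le_right _ _)))) polyVal_order fun _ => ?_)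
    fun k e => by rw [greedySet]
  obtain ⟨q, hq⟩ := polyVal_order
  refine ⟨q, fun k e _ m hm => ?_⟩
  have h := (greedySet_spec k.2.natAdj_symm k.2.not_natAdj_self hm).1
  rw [greedySet] at h
  refine lt_of_lt_of_le ?_ (Nat.pow_le_pow_right (by omega) (hm.trans (hq k e)))
  convert h

theorem feasible_digitColor {m v : GraphInput → (ℕ → ℕ) → ℕ}
    (hm : Feasible inputFamily m) (hv : Feasible inputFamily v) :
    Feasible inputFamily fun k e =>
      digitColor k.1 (greedySet k.1 k.2.NatAdj k.1) (m k e) (v k e) := by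
  classical
  refine (hm.div (.pow 3 (.count feasible_order polyVal_order
    (p := fun k e u => u < v k e ∧ BitMem k.1 (greedySet k.1 k.2.NatAdj k.1) u)
    (.and (.lt (feasible_var 1) (hv.rename (· + 2)))
      (.bitMem feasible_order polyVal_order feasible_greedySet (feasible_var 1))))
    (polyVal_order.of_le fun k e => Nat.count_le _))).mod (feasible_const 3)

theorem feasiblePred_initExcl {m a b w q : GraphInput → (ℕ → ℕ) → ℕ}
    (hm : Feasible inputFamily m) (ha : Feasible inputFamily a) (hb : Feasible inputFamily b)
    (hw : Feasible inputFamily w) (hq : Feasible inputFamily q) :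
    FeasiblePred inputFamily fun k e => InitExcl k.1 (greedySet k.1 k.2.NatAdj k.1)
      (m k e) (a k e) (b k e) (w k e) (q k e) :=
  .or (.and (.bitMem feasible_order polyVal_order feasible_greedySet hw)
    (.ne hq (feasible_digitColor hm hw)))
    (.or (.and (.eq hw ha) (.ne hq (feasible_const 0)))
      (.and (.eq hw hb) (.ne hq (feasible_const 2))))

theorem feasible_propagate {X : GraphInput → (ℕ → ℕ) → ℕ → ℕ → Prop}
    (hX : FeasiblePred inputFamily fun k e => X k (fun j => e (j + 2)) (e 1 / 3) (e 1 % 3)) :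
    Feasible inputFamily fun k e => propagate k.1 k.2.NatAdj (X k e) := by
  have hN := feasible_three_mul_order
  have hNv := polyVal_three_mul_order
  refine .iterate hN hNv (.bitSet hN hNv (p := fun k e i => X k e (i / 3) (i % 3)) hX)
    (F := fun k _ Y => propStep k.1 k.2.NatAdj Y) (.bitSet hN hNv
      (p := fun k e i => BitMem (3 * k.1) (e 0) i ∨ ∃ u < k.1, k.2.NatAdj u (i / 3) ∧
        ∀ p < 3, p + i % 3 ≠ 2 → BitMem (3 * k.1) (e 0) (3 * u + p))
      (.or (.bitMem hN hNv (feasible_var 2) (feasible_var 1))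
        (.exists_lt feasible_order polyVal_order
          (p := fun k e u => k.2.NatAdj u (e 1 / 3) ∧
            ∀ p < 3, p + e 1 % 3 ≠ 2 → BitMem (3 * k.1) (e 2) (3 * u + p))
          (.and (feasiblePred_natAdj (feasible_var 1) (.div (feasible_var 3) (feasible_const 3)))
            (.forall_lt (feasible_const 3) (polyVal_const 3)
              (p := fun (k : GraphInput) e p =>
                p + e 3 % 3 ≠ 2 → BitMem (3 * k.1) (e 4) (3 * e 1 + p))
              (.imp (.ne (.add (feasible_var 1) (.mod (feasible_var 5) (feasible_const 3)))
                  (feasible_const 2))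
                (.bitMem hN hNv (feasible_var 6)
                  (.add (.mul (feasible_const 3) (feasible_var 3)) (feasible_var 1))))))))) ?_
  obtain ⟨q, hq⟩ := hNv
  exact ⟨q, fun k e x => (bitSet_lt _ _).trans_le (Nat.pow_le_pow_right (by omega) (hq k e))⟩

theorem feasiblePred_extends {m a b : GraphInput → (ℕ → ℕ) → ℕ}
    (hm : Feasible inputFamily m) (ha : Feasible inputFamily a) (hb : Feasible inputFamily b) :
    FeasiblePred inputFamily fun k e =>
      Extends k.1 k.2.NatAdj (greedySet k.1 k.2.NatAdj k.1) (m k e) (a k e) (b k e) := by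
  have h3 := feasible_const (I := inputFamily) 3
  have h3v := polyVal_const (I := inputFamily) 3
  let X (k : GraphInput) (e : ℕ → ℕ) (v p w q : ℕ) : Prop :=
    InitExcl k.1 (greedySet k.1 k.2.NatAdj k.1) (m k e) (a k e) (b k e) w q ∨ w = v ∧ q ≠ p
  let R (k : GraphInput) (e : ℕ → ℕ) (v p w q : ℕ) : Prop :=
    ¬ BitMem (3 * k.1) (propagate k.1 k.2.NatAdj (X k e v p)) (3 * w + q)
  -- The variables `7`, `5`, `3`, `1` are the vertex and the colour that are set, and the vertex
  -- and the colour that are tested.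
  have hR : FeasiblePred inputFamily fun k e => R k (fun j => e (j + 8)) (e 7) (e 5) (e 3) (e 1) :=
    .not (.bitMem feasible_three_mul_order polyVal_three_mul_order
      (feasible_propagate (X := fun k e => X k (fun j => e (j + 8)) (e 7) (e 5))
        (.or (feasiblePred_initExcl (hm.rename (· + 10)) (ha.rename (· + 10))
          (hb.rename (· + 10)) (.div (feasible_var 1) h3) (.mod (feasible_var 1) h3))
          (.and (.eq (.div (feasible_var 1) h3) (feasible_var 9))
            (.ne (.mod (feasible_var 1) h3) (feasible_var 7)))))
      (.add (.mul h3 (feasible_var 3)) (feasible_var 1)))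
  exact .forall_lt feasible_order polyVal_order
    (p := fun k e v => ∃ p < 3, ∀ w < k.1, ∃ q < 3, R k e v p w q)
    (.exists_lt h3 h3v
      (p := fun k e p => ∀ w < k.1, ∃ q < 3, R k (fun j => e (j + 2)) (e 1) p w q)
      (.forall_lt feasible_order polyVal_order
        (p := fun k e w => ∃ q < 3, R k (fun j => e (j + 4)) (e 3) (e 1) w q)
        (.exists_lt h3 h3v
          (p := fun k e q => R k (fun j => e (j + 6)) (e 5) (e 3) (e 1) q) hR)))

open Classical in
theorem feasibleW_hasIndepCutset : FeasibleW inputFamily (fun k => 3 ^ k.2.indepNum)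
    fun k _ => if k.2.HasIndepCutset then 1 else 0 := by
  refine (FeasiblePred.exists_lt_weighted (fun k => Nat.one_le_pow _ _ (by omega))
    (g := fun k _ => 3 ^ Nat.count (BitMem k.1 (greedySet k.1 k.2.NatAdj k.1)) k.1 *
      (k.1 * k.1))
    (p := fun k _ j => Extends k.1 k.2.NatAdj (greedySet k.1 k.2.NatAdj k.1) (j / (k.1 * k.1))
      (j / k.1 % k.1) (j % k.1)) ?_ ?_ ?_).congr fun k e => ?_
  · exact .mul (.pow 3 (.count feasible_order polyVal_order
      (p := fun k _ u => BitMem k.1 (greedySet k.1 k.2.NatAdj k.1) u)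
      (.bitMem feasible_order polyVal_order feasible_greedySet (feasible_var 1)))
      (polyVal_order.of_le fun _ _ => Nat.count_le _)) (feasible_order.mul feasible_order)
  · obtain ⟨q, hq⟩ := polyVal_order.mul polyVal_order
    exact ⟨q, fun k e => Nat.mul_le_mul (Nat.pow_le_pow_right (by omega) k.2.count_greedySet_le)
      (hq k e)⟩
  · exact feasiblePred_extends ((feasible_var 1).div (feasible_order.mul feasible_order))
      (((feasible_var 1).div feasible_order).mod feasible_order)
      ((feasible_var 1).mod feasible_order)
  · simp only [hasIndepCutset_iff_exists_lt]

end SimpleGraph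

/-! ### Programs from relocatable code -/

theorem RAM.FeasibleW.exists_program {ι : Type*} {I : InputFamily ι} {w : ι → ℕ}
    (hw : ∀ k, 1 ≤ w k) {f : ι → ℕ} (hf : FeasibleW I w fun k _ => f k) :
    ∃ (P : Program) (q : ℕ), ∀ k, ∃ t, Outputs P (I.cell k) (f k) t ∧ t ≤ w k * I.size k ^ q := by
  obtain ⟨hb, code, h⟩ := hf
  obtain ⟨b, hb⟩ := hb 0
  obtain ⟨q, h⟩ := h 0
  -- Register `1` receives the value, which is then added to register `0`.
  let c := code (fun _ => 0) 1 0
  refine ⟨c ++ [.add 0 0 1], 2 + (b + q), fun k => ?_⟩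
  have he : EnvBound (I.size k) 0 ((fun _ => 0) ∘ fun _ => 0) := fun j => by simp
  have hP : CodeAt (c ++ [.add 0 0 1]) 0 (c ++ [.add 0 0 1]) := fun i hi => by
    rw [zero_add, List.getElem?_eq_getElem hi]
  obtain ⟨t, r, hr, ht, hv, hk⟩ := h k (fun _ => 0) 1 0 _ (fun _ => 0) (by simp) he hP.left
  have hadd := hP.right.head
  have h0 := hk 0 (by omega)
  have hlast : Exec (c ++ [.add 0 0 1]) (I.cell k) ⟨0 + c.length, r⟩ (1 + (f k).size + 0)
      ⟨0 + c.length + 1, Function.update r 0 (f k)⟩ := by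
    refine .next (s₁ := ⟨0 + c.length + 1, Function.update r 0 (f k)⟩) ?_ (.halted ?_)
    · simp [step, State.write, hv, h0]
    · simp [step]
  refine ⟨_, ⟨_, hr _ _ hlast, by simp⟩, ?_⟩
  have h1 : (f k).size ≤ I.size k ^ b := Nat.size_le.2 (hb k _ he)
  have h2 := I.size_pow_mono k (show b ≤ b + q by omega)
  have h3 := I.one_le_size_pow k (b + q)
  have h4 : 1 * I.size k ^ (b + q) ≤ w k * I.size k ^ (b + q) := Nat.mul_le_mul_right _ (hw k)
  have h5 : w k * I.size k ^ q ≤ w k * I.size k ^ (b + q) :=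
    Nat.mul_le_mul_left _ (I.size_pow_mono k (by omega))
  calc t + (1 + (f k).size + 0) ≤ 2 ^ 2 * (w k * I.size k ^ (b + q)) := by omega
    _ = w k * (2 ^ 2 * I.size k ^ (b + q)) := by ring
    _ ≤ w k * I.size k ^ (2 + (b + q)) := Nat.mul_le_mul_left _ (I.two_pow_mul_le k 2 _)

open Classical in
theorem mainTheorem6 :
    ∃ (P : RAM.Program) (C c : ℕ), ∀ (n : ℕ) (G : SimpleGraph (Fin n)), G.Connected →
      ∃ t : ℕ, RAM.Outputs P G.inputArray (if G.HasIndepCutset then 1 else 0) t ∧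
        t ≤ C * 3 ^ G.indepNum * n ^ c := by
  obtain ⟨P, q, h⟩ := SimpleGraph.feasibleW_hasIndepCutset.exists_program
    fun k => Nat.one_le_pow _ _ (by omega)
  refine ⟨P, 3 ^ q, q, fun n G hG => ?_⟩
  obtain ⟨t, ht, htq⟩ := h ⟨n, G⟩
  refine ⟨t, ht, htq.trans ?_⟩
  -- A connected graph has a vertex, so the size `n + 2` is at most `3 * n`.
  have hn : 0 < n := Fin.pos_iff_nonempty.2 hG.nonempty
  calc 3 ^ G.indepNum * (n + 2) ^ q ≤ 3 ^ G.indepNum * (3 * n) ^ q :=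
        Nat.mul_le_mul_left _ (Nat.pow_le_pow_left (by omega) q)
    _ = 3 ^ q * 3 ^ G.indepNum * n ^ q := by rw [mul_pow]; ring
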